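/- **Theorem 6 (Posterior Covariance Recursions).** *Model.* Let $(\Omega,\mathscr F,\mathcal P)$ be a probability space, $a<b$ and $\mathcal Z=[a,b]^M$. The state $(X_t)_{t\ge -1}$ takes values in $\mathbb R^M$, and $X_t\in\mathcal Z$ almost surely for every $t\ge-1$. The observations are $y_t=\mu_t(X_t)+\sqrt{C_t(X_t)}\,u_t\in\mathbb R^N$ for $t\in\mathbb N=\{0,1,\dots\}$, where $u_0,u_1,\dots$ are i.i.d. standard Gaussian vectors and $C_t(x)=\Sigma_t(x)+\sigma_\Sigma^2 I_N$ with $\sigma_\Sigma\ge0$ and $\Sigma_t(x)\succ0$. The functions $\mu_t$ and the entries of $\Sigma_t$ are Lipschitz on $\mathcal Z$ in the $\ell_1$-norm, with constants that do not depend on $t$. The quantities $\|\mu_t(x)\|_2$, $\Sigma_t(x)$ and $\lambda_{\max}(C_t(x))$ are bounded uniformly in $t\in\mathbb N$ and $x\in\mathcal Z$, and $\inf_{t,x}\lambda_{\min}(C_t(x))>1$. Let $\mathscr Y_t=\sigma\{y_0,\dots,y_t\}$. *Grid.* For $L\ge1$ divide $\mathcal Z$ into the $L_S=L^M$ cells $\mathcal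 Z^l_{L_S}$ of the uniform grid with $L$ intervals per coordinate, let $x^l_{L_S}$ be the center of $\mathcal Z^l_{L_S}$, let $\mathcal Q_{L_S}$ map every point of $\mathcal Z$ to the center of its cell, and let $\mathcal Z_{L_S}(x)$ be the cell that contains $x$. Suppose that one of the following holds, and define the transition matrix $P\in[0,1]^{L_S\times L_S}$ accordingly. 1. *(Marginal quantization.)* $X_t$ is a Markov process with time invariant kernel $\mathcal K$, its initial law $\pi=\mathcal P_{X_{-1}}$ is invariant, and $(u_t)$ is independent of $(X_t)$. The kernel is conditionally regular, that is, there are functions $\delta_n\ge0$, $n\ge1$, uniformly integrable with respect to $\pi$ and with $\delta_n\to0$ $\pi$-almost everywhere, such that for $\pi$-almost all $x$ and all $L$ one of these two conditions holds (the same one throughout): * (type I) $\bigl|\mathcal K(\mathcal Z^i_{L_S}|x)-\mathbb E\{\mathcal K(\mathcal Z^i_{L_S}|X_{-1})\,|\,X_{-1}\in\mathcal Z_{L_S}(x)\}\bigr|\le\delta_{L_S}(x)/L_S$ for all $i$; * (type II) $\mathcal K(\cdot|x)$ has a density $\kappa(\cdot|x)$, and $\operatorname{ess\,sup}_{y}\bigl|\kappa(y|x)-\mathbb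 E\{\kappa(y|X_{-1})\,|\,X_{-1}\in\mathcal Z_{L_S}(x)\}\bigr|\le\delta_{L_S}(x)$. Put $P(i,j)=\mathcal P(X_t\in\mathcal Z^i_{L_S}\,|\,X_{t-1}\in\mathcal Z^j_{L_S})$, which does not depend on $t$. 2. *(Markovian quantization.)* $X_t=f(X_{t-1},W_t)$ almost surely for $t\in\mathbb N$, where $(W_t)$ is i.i.d. with values in $\mathcal W\subseteq\mathbb R^{M_W}$ and independent of $X_{-1}$, and $(u_t)$ is independent of $(X_{-1},(W_t))$. The measurable map $f$ maps $\mathcal Z\times\mathcal W$ into $\mathcal Z$, and $\|f(x,w)-f(x',w)\|_1\le K(w)\|x-x'\|_1$ for all $x,x'\in\mathcal Z$ and $w\in\mathcal W$, where $K\ge0$ and $\sup_{\mathcal W}K<\infty$. Put $P(i,j)=\mathcal P\bigl(\mathcal Q_{L_S}(f(x^j_{L_S},W_0))=x^i_{L_S}\bigr)$, the transition matrix of the chain $X^{L_S}_t=\mathcal Q_{L_S}(f(X^{L_S}_{t-1},W_t))$. *Filter.* Define $E_t\in\mathbb R^{L_S}$ by $E_{-1}(l)=\mathcal P(X_{-1}\in\mathcal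 Z^l_{L_S})$ and $E_t=\Lambda_tPE_{t-1}$ for $t\in\mathbb N$, where $\Lambda_t=\operatorname{diag}\bigl((\sqrt{2\pi})^N\,\mathcal N(y_t;\mu_t(x^l_{L_S}),C_t(x^l_{L_S}))\bigr)_l$ and $\mathcal N(\cdot\,;\mu,C)$ is the density of the normal law with mean $\mu$ and covariance $C$. For functions $\phi_t:\mathbb R^M\to\mathbb R^{M_{\phi_t}}$ and $\rho\ge0$ put $\Phi_{t+\rho}=[\phi_{t+\rho}(x^1_{L_S})\,\cdots\,\phi_{t+\rho}(x^{L_S}_{L_S})]$, $p=P^\rho E_t/\|E_t\|_1$ and $$\mathcal V^{L_S}\bigl(\phi_{t+\rho}(X_{t+\rho})\,|\,\mathscr Y_t\bigr)=\Phi_{t+\rho}\bigl[\operatorname{diag}(p)-pp^{\mathsf T}\bigr]\Phi_{t+\rho}^{\mathsf T}.$$ Write $\mathbb V\{V|\mathscr Y_t\}=\mathbb E\{VV^{\mathsf T}|\mathscr Y_t\}-\mathbb E\{V|\mathscr Y_t\}\,\mathbb E\{V|\mathscr Y_t\}^{\mathsf T}$ for the posterior covariance matrix and $\|A\|_1^{\mathsf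 E}=\sum_{i,j}|A(i,j)|$. *Claim.* For every $T\in\mathbb N$ and every constant $C\ge1$ there is a measurable set $\widehat\Omega_T\subseteq\Omega$ with $$\mathcal P(\widehat\Omega_T)\ge1-(T+1)^{1-CN}e^{-CN}$$ such that, for every family $(\phi_t)_{t\in\mathbb N}$ of bounded continuous functions and every prediction horizon $\rho\ge0$, $$\sup_{0\le t\le T}\ \sup_{\omega\in\widehat\Omega_T}\Bigl\|\mathcal V^{L_S}\bigl(\phi_{t+\rho}(X_{t+\rho})|\mathscr Y_t\bigr)-\mathbb V\bigl\{\phi_{t+\rho}(X_{t+\rho})|\mathscr Y_t\bigr\}\Bigr\|_1^{\mathsf E}(\omega)\longrightarrow0\qquad(L\to\infty).$$ Here $\widehat\Omega_T$ does not depend on $(\phi_t)$ and $\rho$. Since conditional expectations are determined only up to null sets, the supremum over $\omega$ omits a null set that may depend on $(\phi_t)$ and $\rho$ (and on the versions chosen), but not on $L$ or $t$. -/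

import Mathlib

open MeasureTheory ProbabilityTheory
open scoped ENNReal NNReal MatrixOrder

namespace GridFilter

noncomputable section

/-! ### Uniform quantization of the cube `[a, b]^M` -/

/-- The essential state space `𝒵 = [a, b]^M`. -/
def box (M : ℕ) (a b : ℝ) : Set (Fin M → ℝ) := Set.Icc (fun _ => a) (fun _ => b)

/-- The `ℓ₁`-norm on `ℝ^ι`. -/
def l1 {ι : Type*} [Fintype ι] (v : ι → ℝ) : ℝ := ∑ i, |v i|

/-- The entrywise `ℓ₁`-norm of a matrix. -/
def entrywiseL1 {ι κ : Type*} [Fintype ι] [Fintype κ] (A : Matrix ι κ ℝ) : ℝ := ∑ i, ∑ j, |A i j|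

/-- Labels of the `L_S = L ^ M` cells of the uniform grid with `L` cells per coordinate. -/
abbrev Grid (M L : ℕ) : Type := Fin M → Fin L

/-- Label of the cell that contains `x`. In each coordinate the interval `[a, b]` is cut into the
`L` intervals `[a + l h, a + (l + 1) h)`, `l < L - 1`, and `[b - h, b]`, where `h = (b - a) / L`. -/
def cellIndex {M : ℕ} (a b : ℝ) (L : ℕ) [NeZero L] (x : Fin M → ℝ) : Grid M L := fun m =>
  ⟨min ⌊(x m - a) / (b - a) * L⌋₊ (L - 1),
    lt_of_le_of_lt (min_le_right _ _) (Nat.sub_lt (NeZero.pos L) Nat.one_pos)⟩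

/-- The quantization cell `𝒵_{L_S}^l` with label `l`. -/
def cell {M : ℕ} (a b : ℝ) (L : ℕ) [NeZero L] (l : Grid M L) : Set (Fin M → ℝ) :=
  {x | x ∈ box M a b ∧ cellIndex a b L x = l}

/-- The reconstruction point `x_{L_S}^l`: the center of the cell with label `l`. -/
def center {M : ℕ} (a b : ℝ) (L : ℕ) (l : Grid M L) : Fin M → ℝ := fun m =>
  a + ((l m : ℕ) + 1 / 2 : ℝ) * ((b - a) / L)

/-! ### Conditionally Gaussian observations -/

/-- Conditional means `μ_t(x)`, the matrices `Σ_t(x)` and the scalar `σ_Σ` of the observations. -/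
structure ObservationModel (M N : ℕ) where
  mean : ℕ → (Fin M → ℝ) → EuclideanSpace ℝ (Fin N)
  Sig : ℕ → (Fin M → ℝ) → Matrix (Fin N) (Fin N) ℝ
  sigma : ℝ

namespace ObservationModel

variable {M N : ℕ} (obs : ObservationModel M N)

/-- The conditional covariance `C_t(x) = Σ_t(x) + σ_Σ² I`. -/
def Cov (t : ℕ) (x : Fin M → ℝ) : Matrix (Fin N) (Fin N) ℝ :=
  obs.Sig t x + obs.sigma ^ 2 • (1 : Matrix (Fin N) (Fin N) ℝ)

/-- The canonical form `μ_t(x) + √(C_t(x)) v` of an observation. -/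
def observe (t : ℕ) (x : Fin M → ℝ) (v : EuclideanSpace ℝ (Fin N)) : EuclideanSpace ℝ (Fin N) :=
  obs.mean t x + Matrix.toEuclideanCLM (𝕜 := ℝ) (CFC.sqrt (obs.Cov t x)) v

/-- The standing assumptions on the observations: `Σ_t(x)` is positive definite, boundedness
(with `λ_inf > 1`), and Lipschitz continuity in `x`, everything uniformly in time. -/
structure Regular (Z : Set (Fin M → ℝ)) : Prop where
  sigma_nonneg : 0 ≤ obs.sigma
  sig_posDef : ∀ t, ∀ x ∈ Z, (obs.Sig t x).PosDef
  sig_bounded : ∃ B : ℝ, ∀ t, ∀ x ∈ Z, ∀ i j, |obs.Sig t x i j| ≤ B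
  eigenvalues_le : ∃ lamSup : ℝ, ∀ t, ∀ x ∈ Z,
    (lamSup • (1 : Matrix (Fin N) (Fin N) ℝ) - obs.Cov t x).PosSemidef
  le_eigenvalues : ∃ lamInf : ℝ, 1 < lamInf ∧ ∀ t, ∀ x ∈ Z,
    (obs.Cov t x - lamInf • (1 : Matrix (Fin N) (Fin N) ℝ)).PosSemidef
  mean_bounded : ∃ muSup : ℝ, ∀ t, ∀ x ∈ Z, ‖obs.mean t x‖ ≤ muSup
  mean_lipschitz : ∃ K : ℝ, ∀ t, ∀ x ∈ Z, ∀ x' ∈ Z,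
    l1 (fun i => obs.mean t x i - obs.mean t x' i) ≤ K * l1 (x - x')
  sig_lipschitz : ∃ K : ℝ, ∀ t, ∀ x ∈ Z, ∀ x' ∈ Z, ∀ i j,
    |obs.Sig t x i j - obs.Sig t x' i j| ≤ K * l1 (x - x')

end ObservationModel

/-- The density of the normal law `𝒩(m, C)` on `ℝ^N` at the point `y`. -/
def gaussianDensity {N : ℕ} (y m : EuclideanSpace ℝ (Fin N)) (C : Matrix (Fin N) (Fin N) ℝ) : ℝ :=
  Real.exp (-(1 / 2) * ((y - m).ofLp ⬝ᵥ (C⁻¹.mulVec (y - m).ofLp))) /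
    (Real.sqrt (2 * Real.pi) ^ N * Real.sqrt C.det)

/-- The likelihood `L_t(x, y) = (√(2π))^N 𝒩(y; μ_t(x), C_t(x))`. -/
def ObservationModel.likelihood {M N : ℕ} (obs : ObservationModel M N) (t : ℕ)
    (x : Fin M → ℝ) (y : EuclideanSpace ℝ (Fin N)) : ℝ :=
  Real.sqrt (2 * Real.pi) ^ N * gaussianDensity y (obs.mean t x) (obs.Cov t x)

/-! ### The grid based filter -/

/-- The likelihood matrix `Λ_t = diag(L_t(x_{L_S}^l, y))_l`. -/
def likelihoodMatrix {M N : ℕ} (obs : ObservationModel M N) (a b : ℝ) (L : ℕ) (t : ℕ)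
    (y : EuclideanSpace ℝ (Fin N)) : Matrix (Grid M L) (Grid M L) ℝ :=
  Matrix.diagonal fun l => obs.likelihood t (center a b L l) y

/-- The unnormalized grid filter, driven by the observed values `y 0, y 1, …`. Time is shifted by
one: `unnormalizedFilter … n` is `E_{n-1}`. It starts at `E_{-1}` and satisfies
`E_t = Λ_t P E_{t-1}`. -/
def unnormalizedFilter {M N : ℕ} (obs : ObservationModel M N) (a b : ℝ) (L : ℕ)
    (Pm : Matrix (Grid M L) (Grid M L) ℝ) (Einit : Grid M L → ℝ)
    (y : ℕ → EuclideanSpace ℝ (Fin N)) : ℕ → Grid M L → ℝ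
  | 0 => Einit
  | t + 1 => (likelihoodMatrix obs a b L t (y t)).mulVec
      (Pm.mulVec (unnormalizedFilter obs a b L Pm Einit y t))

/-- The initial vector `E_{-1}`: the law of the quantized initial state. -/
def initialVector {Ω : Type*} [MeasurableSpace Ω] {M : ℕ} (P : Measure Ω) (a b : ℝ)
    (Xinit : Ω → Fin M → ℝ) (L : ℕ) [NeZero L] : Grid M L → ℝ :=
  fun l => P.real (Xinit ⁻¹' cell a b L l)

/-- The probability vector `p = P^ρ E / ‖E‖₁`. -/
def predictive {M L : ℕ} (Pm : Matrix (Grid M L) (Grid M L) ℝ) (ρ : ℕ) (E : Grid M L → ℝ) :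
    Grid M L → ℝ :=
  (l1 E)⁻¹ • (Pm ^ ρ).mulVec E

/-- The matrix `Φ = [φ(x_{L_S}^1) … φ(x_{L_S}^{L_S})]`. -/
def functionalMatrix {M k : ℕ} (a b : ℝ) (L : ℕ) (φ : (Fin M → ℝ) → Fin k → ℝ) :
    Matrix (Fin k) (Grid M L) ℝ :=
  Matrix.of fun i l => φ (center a b L l) i

/-- The matrix `Φ [diag(p) - p pᵀ] Φᵀ`. -/
def gridCovariance {k : ℕ} {ι : Type*} [Fintype ι] [DecidableEq ι] (Φ : Matrix (Fin k) ι ℝ)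
    (p : ι → ℝ) : Matrix (Fin k) (Fin k) ℝ :=
  Φ * (Matrix.diagonal p - Matrix.vecMulVec p p) * Φ.transpose

/-! ### The optimal filter -/

/-- The `σ`-algebra generated by `Z 0, …, Z t`. -/
abbrev past {Ω E : Type*} [MeasurableSpace E] (Z : ℕ → Ω → E) (t : ℕ) : MeasurableSpace Ω :=
  ⨆ i ≤ t, MeasurableSpace.comap (Z i) inferInstance

/-- The posterior covariance matrix `𝔼[V Vᵀ | 𝒴] - 𝔼[V | 𝒴] 𝔼[V | 𝒴]ᵀ`. -/
def posteriorCovariance {Ω : Type*} [MeasurableSpace Ω] {k : ℕ} (P : Measure Ω)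
    (𝒴 : MeasurableSpace Ω) (V : Ω → Fin k → ℝ) (ω : Ω) : Matrix (Fin k) (Fin k) ℝ :=
  Matrix.of fun i j =>
    (P[fun ω' => V ω' i * V ω' j | 𝒴]) ω - (P[fun ω' => V ω' i | 𝒴]) ω * (P[fun ω' => V ω' j | 𝒴]) ω

/-! ### Marginal quantization -/

/-- The transition matrix of the marginal quantization, `P(i, j) = 𝒫(X_t ∈ 𝒵^i | X_{t-1} ∈ 𝒵^j)`,
written for the first transition (the state is stationary). The entries of a column whose
conditioning event is null are zero; such a column is never charged. -/
def marginalTransition {Ω : Type*} [MeasurableSpace Ω] {M : ℕ} (P : Measure Ω) (a b : ℝ)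
    (X : ℕ → Ω → Fin M → ℝ) (L : ℕ) [NeZero L] : Matrix (Grid M L) (Grid M L) ℝ :=
  Matrix.of fun i j => (cond P (X 0 ⁻¹' cell a b L j)).real (X 1 ⁻¹' cell a b L i)

/-- The average over the cell that contains `x`, with respect to the law `π`:
`𝔼[g(X) | X ∈ 𝒵_{L_S}(x)]` for `X ∼ π`. With `g = 𝒦(𝒜 | ·)` it is the cumulative kernel, with
`g = κ(y | ·)` the cumulative kernel density. -/
def cellAverage {M : ℕ} (π : Measure (Fin M → ℝ)) (a b : ℝ) (L : ℕ) [NeZero L]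
    (g : (Fin M → ℝ) → ℝ) (x : Fin M → ℝ) : ℝ :=
  (∫ θ in cell a b L (cellIndex a b L x), g θ ∂π) / π.real (cell a b L (cellIndex a b L x))

/-- Conditional regularity of type I of the kernel `𝒦` with respect to the law `π`. -/
def CRTI {M : ℕ} (π : Measure (Fin M → ℝ)) (a b : ℝ)
    (K : Kernel (Fin M → ℝ) (Fin M → ℝ)) : Prop :=
  ∃ δ : ℕ → (Fin M → ℝ) → ℝ, (∀ n x, 0 ≤ δ n x) ∧ UniformIntegrable δ 1 π ∧
    (∀ᵐ x ∂π, Filter.Tendsto (fun n => δ n x) Filter.atTop (nhds 0)) ∧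
    ∀ᵐ x ∂π, ∀ (L : ℕ) [NeZero L] (l : Grid M L),
      |(K x).real (cell a b L l) - cellAverage π a b L (fun θ => (K θ).real (cell a b L l)) x|
        ≤ δ (L ^ M) x / ((L ^ M : ℕ) : ℝ)

/-- Conditional regularity of type II of the kernel `𝒦` with respect to the law `π`: there is a
kernel density `κ x y = κ(y | x)`, close to the cumulative one. -/
def CRTII {M : ℕ} (π : Measure (Fin M → ℝ)) (a b : ℝ)
    (K : Kernel (Fin M → ℝ) (Fin M → ℝ)) : Prop :=
  ∃ κ : (Fin M → ℝ) → (Fin M → ℝ) → ℝ, Measurable (Function.uncurry κ) ∧ (∀ x y, 0 ≤ κ x y) ∧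
    (∀ᵐ x ∂π, K x = volume.withDensity (fun y => ENNReal.ofReal (κ x y))) ∧
    ∃ δ : ℕ → (Fin M → ℝ) → ℝ, (∀ n x, 0 ≤ δ n x) ∧ UniformIntegrable δ 1 π ∧
      (∀ᵐ x ∂π, Filter.Tendsto (fun n => δ n x) Filter.atTop (nhds 0)) ∧
      ∀ᵐ x ∂π, ∀ (L : ℕ) [NeZero L],
        ∀ᵐ y, |κ x y - cellAverage π a b L (fun θ => κ θ y) x| ≤ δ (L ^ M) x

/-- The setting of marginal quantizations. Time is shifted by one: `X n` is the state at time
`n - 1`, so `X 0` is the initial state. The state is a Markov process with kernel `K`, its initial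
law is invariant, it is independent of the observation noise `u`, and it is conditionally
regular. -/
structure MarginalSetting {Ω E : Type*} [MeasurableSpace Ω] [MeasurableSpace E] {M : ℕ}
    (P : Measure Ω) (a b : ℝ) (X : ℕ → Ω → Fin M → ℝ) (u : ℕ → Ω → E)
    (K : Kernel (Fin M → ℝ) (Fin M → ℝ)) : Prop where
  isMarkovKernel : IsMarkovKernel K
  markov : ∀ n, ∀ A, MeasurableSet A →
    P[(X (n + 1) ⁻¹' A).indicator (fun _ => (1 : ℝ)) | past X n]
      =ᵐ[P] fun ω => (K (X n ω)).real A
  stationary : K.Invariant (P.map (X 0))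
  indep_noise : IndepFun (fun ω n => X n ω) (fun ω t => u t ω) P
  regular : CRTI (P.map (X 0)) a b K ∨ CRTII (P.map (X 0)) a b K

/-! ### Markovian quantization -/

/-- The transition matrix of the Markovian quantization `X_t^{L_S} = 𝒬(f(X_{t-1}^{L_S}, W_t))`:
`P(i, j)` is the probability that `𝒬` maps `f(x_{L_S}^j, W)` to `x_{L_S}^i`, where `W ∼ ν`. -/
def markovianTransition {M k : ℕ} (ν : Measure (Fin k → ℝ)) (a b : ℝ)
    (f : (Fin M → ℝ) → (Fin k → ℝ) → Fin M → ℝ) (L : ℕ) [NeZero L] :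
    Matrix (Grid M L) (Grid M L) ℝ :=
  Matrix.of fun i j => ν.real {w | f (center a b L j) w ∈ cell a b L i}

/-- The setting of Markovian quantizations. With the same time shift for the state,
`X_t = f(X_{t-1}, W_t)` for an i.i.d. process `W` with values in `S`, which is independent of the
initial state; the observation noise `u` is independent of the initial state and of `W`; and `f`
is Lipschitz in the state on `[a, b]^M`, with constants that are bounded on `S`. -/
structure MarkovianSetting {Ω E : Type*} [MeasurableSpace Ω] [MeasurableSpace E] {M k : ℕ}
    (P : Measure Ω) (a b : ℝ) (X : ℕ → Ω → Fin M → ℝ) (u : ℕ → Ω → E)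
    (S : Set (Fin k → ℝ)) (f : (Fin M → ℝ) → (Fin k → ℝ) → Fin M → ℝ)
    (W : ℕ → Ω → Fin k → ℝ) : Prop where
  measurable_f : Measurable (Function.uncurry f)
  measurable_W : ∀ t, Measurable (W t)
  W_mem : ∀ t, ∀ᵐ ω ∂P, W t ω ∈ S
  maps_box : ∀ w ∈ S, ∀ x ∈ box M a b, f x w ∈ box M a b
  lipschitz : ∃ K : (Fin k → ℝ) → ℝ, (∀ w ∈ S, 0 ≤ K w) ∧ BddAbove (K '' S) ∧
    ∀ w ∈ S, ∀ x ∈ box M a b, ∀ x' ∈ box M a b, l1 (f x w - f x' w) ≤ K w * l1 (x - x')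
  transition : ∀ t, ∀ᵐ ω ∂P, X (t + 1) ω = f (X t ω) (W t ω)
  W_indep : iIndepFun W P
  W_identDistrib : ∀ t, IdentDistrib (W t) (W 0) P P
  indep_init : IndepFun (X 0) (fun ω t => W t ω) P
  indep_noise : IndepFun (fun ω => (X 0 ω, fun t => W t ω)) (fun ω t => u t ω) P

end

end GridFilter

open GridFilter

/-! ### Densities of products and of Gaussian laws -/

/-! Conditionally on the path of the state, the observations are independent Gaussian vectors, so
the pair (path, observations up to time t) has the product of the likelihoods as density with
respect to (law of the path) ⊗ (a multiple of Lebesgue measure). Bayes' formula then writes every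
posterior expectation as a ratio of two integrals over the path in which the observed values y are
mere parameters (`condExp_state_eq_ratio`). The grid filter is a ratio of the same form: prediction
over ρ steps is filtering with weight 1, and the norm of the filter is the sum of its entries. A
posterior covariance is a polynomial in such ratios, so it suffices that numerators and denominators
converge, uniformly in y.

The uniformity comes from the choice of the good event: all observations up to T stay in a ball of
radius R. For y in this ball and x in the cube the likelihood is bounded, uniformly equicontinuous
in x, and bounded away from 0, so the denominators cannot degenerate. A large R makes the
exceptional probability smaller than any prescribed positive number, in particular smaller than the
stated bound.

It remains to show `FilterConsistent`: weighted sums over the grid converge to path integrals,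
uniformly over tame families of weights. In the Markovian case the filter is a Feynman–Kac
expectation for the quantized chain, and the chain, driven by the same noise as the state, follows
it with a pathwise error of order 1/L at each fixed time. In the marginal case the proof uses no
pathwise comparison. There the recursion is moved onto the test functions: functions of the label
converge in L¹(π) to functions of the state, and this convergence survives multiplication by weights
and one application of the transposed transition matrix, by conditional regularity and the
invariance of π. -/

theorem lintegral_fin_prod_eq_prod {n : ℕ} {E : Type*} [MeasurableSpace E]
    (μ : Fin n → Measure E) [∀ i, SigmaFinite (μ i)] (f : Fin n → E → ℝ≥0∞)
    (hf : ∀ i, Measurable (f i)) :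
    ∫⁻ x, ∏ i, f i (x i) ∂(Measure.pi μ) = ∏ i, ∫⁻ x, f i x ∂(μ i) := by
  induction n with
  | zero => simp
  | succ n ih =>
    rw [← (measurePreserving_piFinSuccAbove μ 0).symm.lintegral_comp (by fun_prop)]
    simp only [MeasurableEquiv.piFinSuccAbove_symm_apply, Fin.insertNthEquiv,
      Fin.prod_univ_succ, Fin.insertNth_zero, Equiv.coe_fn_mk, Fin.cons_succ, Fin.zero_succAbove,
      Fin.cons_zero]
    rw [← ih (fun i => μ i.succ) (fun i => f i.succ) (fun i => hf _)]
    exact lintegral_prod_mul (μ := μ 0) (ν := Measure.pi fun i => μ i.succ) (f := f 0) (g := fun x : Fin n → E => ∏ i, f i.succ (x i))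
      (hf 0).aemeasurable (Finset.measurable_fun_prod _ fun i _ =>
        (hf i.succ).comp (measurable_pi_apply i)).aemeasurable

theorem pi_withDensity {n : ℕ} {E : Type*} [MeasurableSpace E]
    (μ : Fin n → Measure E) [∀ i, SigmaFinite (μ i)] (f : Fin n → E → ℝ≥0∞)
    (hf : ∀ i, Measurable (f i)) [∀ i, SigmaFinite ((μ i).withDensity (f i))] :
    Measure.pi (fun i => (μ i).withDensity (f i))
      = (Measure.pi μ).withDensity (fun x => ∏ i, f i (x i)) := by
  refine Measure.pi_eq fun s hs => ?_
  rw [withDensity_apply _ (MeasurableSet.univ_pi hs), Measure.restrict_pi_pi,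
    lintegral_fin_prod_eq_prod _ f hf]
  exact Finset.prod_congr rfl fun i _ => (withDensity_apply _ (hs i)).symm

/-- The standard Gaussian is the image of a product of one-dimensional Gaussians under
`WithLp.toLp`, which preserves volume; the one-dimensional densities multiply. -/
theorem stdGaussian_eq_withDensity (N : ℕ) :
    stdGaussian (EuclideanSpace ℝ (Fin N)) = volume.withDensity (fun v =>
      ENNReal.ofReal ((Real.sqrt (2 * Real.pi))⁻¹ ^ N * Real.exp (-(1 / 2) * (v.ofLp ⬝ᵥ v.ofLp)))) := by
  have hpi : Measure.pi (fun _ : Fin N => gaussianReal 0 1)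
      = (volume : Measure (Fin N → ℝ)).withDensity (fun x => ∏ i, gaussianPDF 0 1 (x i)) := by
    have h1 : gaussianReal 0 1 = (volume : Measure ℝ).withDensity (gaussianPDF 0 1) :=
      gaussianReal_of_var_ne_zero 0 one_ne_zero
    have : SigmaFinite ((volume : Measure ℝ).withDensity (gaussianPDF 0 1)) := by
      rw [← h1]; infer_instance
    rw [h1, volume_pi]
    exact pi_withDensity (fun _ => volume) (fun _ => gaussianPDF 0 1)
      (fun _ => measurable_gaussianPDF 0 1)
  rw [← map_pi_eq_stdGaussian, hpi]
  refine Measure.ext_of_lintegral _ fun F hF => ?_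
  rw [lintegral_map hF (by fun_prop), lintegral_withDensity_eq_lintegral_mul _ (by fun_prop)
    (by fun_prop), lintegral_withDensity_eq_lintegral_mul _ (by fun_prop) hF,
    ← (PiLp.volume_preserving_toLp (Fin N)).lintegral_comp (by fun_prop)]
  refine lintegral_congr fun x => ?_
  simp only [Pi.mul_apply, gaussianPDF]
  congr 1
  rw [← ENNReal.ofReal_prod_of_nonneg (fun i _ => gaussianPDFReal_nonneg 0 1 _)]
  congr 1
  simp only [gaussianPDFReal, Finset.prod_mul_distrib, Finset.prod_const, Finset.card_univ,
    Fintype.card_fin, ← Real.exp_sum, dotProduct, Finset.mul_sum]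
  congr 2
  · simp
  · refine Finset.sum_congr rfl fun i _ => ?_
    simp; ring

theorem measurable_gaussianDensity {N : ℕ} (m : EuclideanSpace ℝ (Fin N))
    (C : Matrix (Fin N) (Fin N) ℝ) : Measurable fun y => gaussianDensity y m C := by
  unfold gaussianDensity
  refine Continuous.measurable ?_
  fun_prop

/-- Change of variables y = m + Av with A = √C. Since A is symmetric and A² = C, the quadratic form
|A⁻¹w|² equals wᵀC⁻¹w, and the Jacobian det A is √(det C). -/
theorem map_stdGaussian_eq_withDensity {N : ℕ} (m : EuclideanSpace ℝ (Fin N))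
    {C : Matrix (Fin N) (Fin N) ℝ} (hC : C.PosDef) :
    (stdGaussian (EuclideanSpace ℝ (Fin N))).map
        (fun v => m + Matrix.toEuclideanCLM (𝕜 := ℝ) (CFC.sqrt C) v)
      = volume.withDensity (fun y => ENNReal.ofReal (gaussianDensity y m C)) := by
  set A := CFC.sqrt C with hA
  have hCp : 0 < C.det := hC.det_pos
  have hdetA : A.det = Real.sqrt C.det := by
    rw [hA, hC.posSemidef.det_sqrt, RCLike.sqrt_of_nonneg hCp.le]; simp
  have hdet0 : A.det ≠ 0 := by rw [hdetA]; positivity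
  have hAA : A * A = C := CFC.sqrt_mul_sqrt_self C hC.posSemidef.nonneg
  have hAT : A.transpose = A := by
    have := (Matrix.nonneg_iff_posSemidef.1 (CFC.sqrt_nonneg C)).isHermitian
    rw [Matrix.IsHermitian, Matrix.conjTranspose_eq_transpose_of_trivial] at this
    exact this
  set B := A⁻¹ with hB
  have hBA : B * A = 1 := Matrix.nonsing_inv_mul _ (isUnit_iff_ne_zero.2 hdet0)
  have hBB : B.transpose * B = C⁻¹ := by
    rw [hB, Matrix.transpose_nonsing_inv, hAT, ← hAA, Matrix.mul_inv_rev]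
  have hquad : ∀ w : Fin N → ℝ, (B.mulVec w) ⬝ᵥ (B.mulVec w) = w ⬝ᵥ (C⁻¹.mulVec w) := by
    intro w
    rw [← hBB, ← Matrix.mulVec_mulVec, Matrix.dotProduct_mulVec w, Matrix.vecMul_transpose]
  set f : EuclideanSpace ℝ (Fin N) →ₗ[ℝ] EuclideanSpace ℝ (Fin N) :=
    (Matrix.toEuclideanCLM (𝕜 := ℝ) A).toLinearMap with hf
  have hfdet : LinearMap.det f = A.det := by
    rw [hf, Matrix.coe_toEuclideanCLM_eq_toEuclideanLin]
    have h := LinearMap.det_conj (Matrix.toLin' A) (WithLp.linearEquiv 2 ℝ (Fin N → ℝ)).symm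
    rw [LinearMap.det_toLin'] at h
    exact h
  have hmap : (volume : Measure (EuclideanSpace ℝ (Fin N))).map (fun v => m + f v)
      = ENNReal.ofReal |A.det⁻¹| • volume := by
    have h1 := Measure.map_linearMap_addHaar_eq_smul_addHaar
      (volume : Measure (EuclideanSpace ℝ (Fin N))) (f := f) (by rw [hfdet]; exact hdet0)
    have hfm : Measurable f := (Matrix.toEuclideanCLM (𝕜 := ℝ) A).continuous.measurable
    rw [show (fun v => m + f v) = (fun v => m + v) ∘ f from rfl,
      ← Measure.map_map (by fun_prop) hfm, h1, Measure.map_smul, hfdet]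
    congr 1
    exact (measurePreserving_add_left volume m).map_eq
  rw [stdGaussian_eq_withDensity]
  refine Measure.ext_of_lintegral _ fun F hF => ?_
  have hmeas : Measurable (fun v => m + Matrix.toEuclideanCLM (𝕜 := ℝ) A v) := by fun_prop
  rw [lintegral_map hF hmeas, lintegral_withDensity_eq_lintegral_mul _ (by fun_prop)
    (g := fun v => F (m + Matrix.toEuclideanCLM (𝕜 := ℝ) A v)) (hF.comp hmeas), lintegral_withDensity_eq_lintegral_mul _
      (measurable_gaussianDensity m C).ennreal_ofReal hF]
  -- The integrand as a function of y; the matrix B = A⁻¹ recovers v from y - m.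
  set G : EuclideanSpace ℝ (Fin N) → ℝ≥0∞ := fun y => ENNReal.ofReal ((Real.sqrt (2 * Real.pi))⁻¹ ^ N
    * Real.exp (-(1 / 2) * ((B.mulVec (y - m).ofLp) ⬝ᵥ (B.mulVec (y - m).ofLp)))) * F y with hG
  have hGm : Measurable G := by
    refine Measurable.mul (Continuous.measurable ?_).ennreal_ofReal hF
    fun_prop
  have hmap' : Measurable (fun v => m + f v) := hmeas
  calc _ = ∫⁻ v, G (m + f v) := by
        refine lintegral_congr fun v => ?_
        have : B.mulVec ((m + f v) - m).ofLp = v.ofLp := by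
          rw [add_sub_cancel_left, hf]
          change B.mulVec (Matrix.toEuclideanCLM (𝕜 := ℝ) A v).ofLp = _
          rw [Matrix.ofLp_toEuclideanCLM, Matrix.mulVec_mulVec, hBA, Matrix.one_mulVec]
        simp only [hG, this, Pi.mul_apply]
        rfl
    _ = ∫⁻ y, G y ∂(volume.map (fun v => m + f v)) := (lintegral_map hGm hmap').symm
    _ = ∫⁻ y, ENNReal.ofReal |A.det⁻¹| * G y := by
        rw [hmap, lintegral_smul_measure, lintegral_const_mul _ hGm, smul_eq_mul]
    _ = _ := by
        refine lintegral_congr fun y => ?_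
        simp only [hG, Pi.mul_apply]
        rw [← mul_assoc, ← ENNReal.ofReal_mul (abs_nonneg _)]
        congr 2
        rw [hquad, hdetA, abs_of_nonneg (by positivity), gaussianDensity, inv_pow]
        field_simp

/-- The measure with respect to which `likelihood` is the density of an observation. -/
noncomputable def refMeasure (N : ℕ) : Measure (EuclideanSpace ℝ (Fin N)) :=
  Real.toNNReal ((Real.sqrt (2 * Real.pi) ^ N)⁻¹) • volume

instance (N : ℕ) : SigmaFinite (refMeasure N) := by
  unfold refMeasure; infer_instance

theorem refMeasure_eq (N : ℕ) :
    refMeasure N = ENNReal.ofReal ((Real.sqrt (2 * Real.pi) ^ N)⁻¹) • volume := rfl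

theorem map_observe_eq_withDensity {M N : ℕ} (obs : ObservationModel M N) (t : ℕ)
    (x : Fin M → ℝ) (hC : (obs.Cov t x).PosDef) :
    (stdGaussian (EuclideanSpace ℝ (Fin N))).map (obs.observe t x)
      = (refMeasure N).withDensity (fun y => ENNReal.ofReal (obs.likelihood t x y)) := by
  have := map_stdGaussian_eq_withDensity (obs.mean t x) hC
  unfold ObservationModel.observe
  rw [this, refMeasure_eq, withDensity_smul_measure, ← withDensity_smul' _ _ ENNReal.ofReal_ne_top]
  congr 1
  ext y
  rw [Pi.smul_apply, smul_eq_mul, ← ENNReal.ofReal_mul (by positivity)]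
  congr 1
  unfold ObservationModel.likelihood
  field_simp

/-! ### Bayes' formula -/

/-- Fubini under the joint density. It evaluates integrals over the events {V ∈ A} that test a
conditional expectation given V. -/
theorem setIntegral_preimage_of_map_eq_withDensity {Ω α β : Type*} [MeasurableSpace Ω]
    [MeasurableSpace α] [MeasurableSpace β] {P : Measure Ω} [IsProbabilityMeasure P]
    {Z : Ω → α} {V : Ω → β} (hZ : Measurable Z) (hV : Measurable V)
    {Q : Measure α} [IsProbabilityMeasure Q] {lam : Measure β} [SigmaFinite lam]
    {g : α × β → ℝ} (hg : Measurable g) (hg0 : ∀ p, 0 ≤ g p)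
    (hmap : P.map (fun ω => (Z ω, V ω)) = (Q.prod lam).withDensity fun p => ENNReal.ofReal (g p))
    {k : α × β → ℝ} (hk : Measurable k) {B : ℝ} (hkB : ∀ p, |k p| ≤ B)
    {A : Set β} (hA : MeasurableSet A) :
    ∫ ω in V ⁻¹' A, k (Z ω, V ω) ∂P = ∫ y in A, ∫ x, k (x, y) * g (x, y) ∂Q ∂lam := by
  have hZV : Measurable fun ω => (Z ω, V ω) := hZ.prodMk hV
  have hA' : MeasurableSet (Prod.snd ⁻¹' A : Set (α × β)) := measurable_snd hA
  have hgr : Measurable fun p => Real.toNNReal (g p) := hg.real_toNNReal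
  have hmap' : P.map (fun ω => (Z ω, V ω))
      = (Q.prod lam).withDensity fun p => ((Real.toNNReal (g p) : ℝ≥0) : ℝ≥0∞) := hmap
  have hprob : IsProbabilityMeasure (P.map fun ω => (Z ω, V ω)) :=
    Measure.isProbabilityMeasure_map hZV.aemeasurable
  have hint : Integrable k (P.map fun ω => (Z ω, V ω)) :=
    Integrable.of_bound hk.aestronglyMeasurable B (ae_of_all _ hkB)
  rw [hmap', integrable_withDensity_iff_integrable_smul hgr] at hint
  have h1 : ∫ ω in V ⁻¹' A, k (Z ω, V ω) ∂P
      = ∫ p in Prod.snd ⁻¹' A, k p ∂(P.map fun ω => (Z ω, V ω)) := by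
    rw [setIntegral_map hA' hk.aestronglyMeasurable hZV.aemeasurable]; rfl
  rw [h1, hmap', setIntegral_withDensity_eq_setIntegral_smul hgr _ hA']
  have h2 : (Prod.snd ⁻¹' A : Set (α × β)) = Set.univ ×ˢ A := by ext; simp
  have h3 : ∀ p, (Real.toNNReal (g p)) • k p = k p * g p := fun p => by
    rw [NNReal.smul_def, Real.coe_toNNReal _ (hg0 p), smul_eq_mul, mul_comm]
  simp only [h3] at hint ⊢
  rw [h2, ← Measure.prod_restrict, Measure.restrict_univ, integral_prod_symm]
  rw [← Measure.restrict_univ (μ := Q), Measure.prod_restrict]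
  exact hint.integrableOn

/-- Bayes' formula for a pair whose joint law has a density with respect to a product measure. -/
theorem condExp_eq_ratio_of_map_eq_withDensity {Ω α β : Type*} [MeasurableSpace Ω]
    [MeasurableSpace α] [MeasurableSpace β] {P : Measure Ω} [IsProbabilityMeasure P]
    {Z : Ω → α} {V : Ω → β} (hZ : Measurable Z) (hV : Measurable V)
    {Q : Measure α} [IsProbabilityMeasure Q] {lam : Measure β} [SigmaFinite lam]
    {g : α × β → ℝ} (hg : Measurable g) (hg0 : ∀ p, 0 ≤ g p)
    (hmap : P.map (fun ω => (Z ω, V ω)) = (Q.prod lam).withDensity fun p => ENNReal.ofReal (g p))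
    (hgint : ∀ y, Integrable (fun x => g (x, y)) Q)
    {h : α → ℝ} (hh : Measurable h) {B : ℝ} (hhB : ∀ x, |h x| ≤ B) :
    P[fun ω => h (Z ω) | MeasurableSpace.comap V inferInstance] =ᵐ[P]
      fun ω => (∫ x, h x * g (x, V ω) ∂Q) / ∫ x, g (x, V ω) ∂Q := by
  set num : β → ℝ := fun y => ∫ x, h x * g (x, y) ∂Q with hnum
  set den : β → ℝ := fun y => ∫ x, g (x, y) ∂Q with hden
  have hnumm : Measurable num := by
    have : StronglyMeasurable fun p : β × α => h p.2 * g (p.2, p.1) :=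
      Measurable.stronglyMeasurable (by fun_prop)
    exact this.integral_prod_right'.measurable
  have hdenm : Measurable den := by
    have : StronglyMeasurable fun p : β × α => g (p.2, p.1) :=
      Measurable.stronglyMeasurable (by fun_prop)
    exact this.integral_prod_right'.measurable
  have hnumle : ∀ y, |num y| ≤ B * den y := fun y => by
    rw [hnum, hden]; dsimp only
    rw [← integral_const_mul, ← Real.norm_eq_abs]
    refine norm_integral_le_of_norm_le ((hgint y).const_mul B) (ae_of_all _ fun x => ?_)
    rw [Real.norm_eq_abs, abs_mul, abs_of_nonneg (hg0 _)]
    exact mul_le_mul_of_nonneg_right (hhB x) (hg0 _)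
  have hden0 : ∀ y, 0 ≤ den y := fun y => integral_nonneg fun x => hg0 _
  -- Where the denominator vanishes, |num| ≤ B · den makes the numerator vanish too, so the
  -- convention x / 0 = 0 does no harm.
  have hmul : ∀ y, num y / den y * den y = num y := fun y => by
    rcases eq_or_ne (den y) 0 with h0 | h0
    · have := hnumle y
      rw [h0, mul_zero] at this
      rw [h0, abs_nonpos_iff.1 this, mul_zero]
    · exact div_mul_cancel₀ _ h0
  have hratio : ∀ y, |num y / den y| ≤ |B| := fun y => by
    rw [abs_div, abs_of_nonneg (hden0 y)]
    refine div_le_of_le_mul₀ (hden0 y) (abs_nonneg _) ((hnumle y).trans ?_)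
    exact mul_le_mul_of_nonneg_right (le_abs_self B) (hden0 y)
  have hrm : Measurable fun y => num y / den y := hnumm.div hdenm
  refine (ae_eq_condExp_of_forall_setIntegral_eq (hV.comap_le) ?_ ?_ ?_ ?_).symm
  · exact Integrable.of_bound (hh.comp hZ).aestronglyMeasurable B (ae_of_all _ fun ω => hhB _)
  · intro s _ _
    exact (Integrable.of_bound (hrm.comp hV).aestronglyMeasurable |B|
      (ae_of_all _ fun ω => hratio _)).integrableOn
  · rintro s ⟨A, hA, rfl⟩ _
    -- The ratio depends on y alone and leaves the inner integral, where it meets den; by `hmul`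
    -- this gives num, the inner integral for h.
    have e1 := setIntegral_preimage_of_map_eq_withDensity hZ hV hg hg0 hmap
      (k := fun p => num p.2 / den p.2) (by fun_prop) (B := |B|) (fun p => hratio p.2) hA
    have e2 := setIntegral_preimage_of_map_eq_withDensity hZ hV hg hg0 hmap
      (k := fun p => h p.1) (by fun_prop) (B := B) (fun p => hhB p.1) hA
    dsimp only at e1 e2
    rw [e2, e1]
    congr 1
    ext y
    rw [integral_const_mul]
    exact hmul y
  · exact (hrm.comp (comap_measurable V)).stronglyMeasurable.aestronglyMeasurable

/-! ### Observation models with continuous coefficients -/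

/-- The coefficients of the observations are continuous, and `C_t(x)` is positive definite. -/
structure GridFilter.ObservationModel.IsContinuous {M N : ℕ} (obs : ObservationModel M N) : Prop where
  mean : ∀ t, Continuous (obs.mean t)
  cov : ∀ t, Continuous (obs.Cov t)
  posDef : ∀ t x, (obs.Cov t x).PosDef

section ContinuousModel

variable {M N : ℕ} {obs : ObservationModel M N}

-- The continuous functional calculus is continuous in the matrix for the operator norm. The square
-- root is continuous on all of `ℝ≥0`, so the spectra need not be confined to a smaller set.
open scoped Matrix.Norms.L2Operator in
theorem continuous_matrix_sqrt {X : Type*} [TopologicalSpace X]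
    {f : X → Matrix (Fin N) (Fin N) ℝ} (hf : Continuous f) (hp : ∀ x, (f x).PosSemidef) :
    Continuous fun x => CFC.sqrt (f x) := by
  simp only [CFC.sqrt_eq_cfc]
  exact Continuous.cfc_nnreal_of_mem_nhdsSet (s := Set.univ) _ Filter.univ_mem hf
    (fun x => (hp x).nonneg) NNReal.continuous_sqrt.continuousOn

theorem GridFilter.ObservationModel.IsContinuous.continuous_observe (hobs : obs.IsContinuous) (t : ℕ) :
    Continuous fun p : (Fin M → ℝ) × EuclideanSpace ℝ (Fin N) => obs.observe t p.1 p.2 := by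
  have h1 : Continuous fun p : (Fin M → ℝ) × EuclideanSpace ℝ (Fin N) =>
      CFC.sqrt (obs.Cov t p.1) :=
    (continuous_matrix_sqrt (hobs.cov t) fun x => (hobs.posDef t x).posSemidef).comp continuous_fst
  have h2 : Continuous fun p : (Fin M → ℝ) × EuclideanSpace ℝ (Fin N) =>
      WithLp.toLp 2 ((CFC.sqrt (obs.Cov t p.1)).mulVec p.2.ofLp) := by
    refine (PiLp.continuous_toLp 2 _).comp (h1.matrix_mulVec ?_)
    exact (PiLp.continuous_ofLp 2 _).comp continuous_snd
  exact ((hobs.mean t).comp continuous_fst).add h2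

theorem GridFilter.ObservationModel.IsContinuous.continuous_likelihood (hobs : obs.IsContinuous) (t : ℕ) :
    Continuous fun p : (Fin M → ℝ) × EuclideanSpace ℝ (Fin N) => obs.likelihood t p.1 p.2 := by
  have hdet : ∀ x, 0 < (obs.Cov t x).det := fun x => (hobs.posDef t x).det_pos
  have hdc : Continuous fun x => (obs.Cov t x).det := (hobs.cov t).matrix_det
  have hinv : Continuous fun x => (obs.Cov t x)⁻¹ := by
    simp only [Matrix.inv_def, Ring.inverse_eq_inv']
    exact (hdc.inv₀ fun x => (hdet x).ne').smul (hobs.cov t).matrix_adjugate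
  unfold ObservationModel.likelihood gaussianDensity
  refine continuous_const.mul (Continuous.div ?_ ?_ fun p => ?_)
  · have hm := hobs.mean t
    have h3 : Continuous fun p : (Fin M → ℝ) × EuclideanSpace ℝ (Fin N) =>
        (p.2 - obs.mean t p.1).ofLp :=
      (PiLp.continuous_ofLp 2 _).comp (continuous_snd.sub (hm.comp continuous_fst))
    exact Real.continuous_exp.comp (continuous_const.mul
      (h3.dotProduct ((hinv.comp continuous_fst).matrix_mulVec h3)))
  · exact continuous_const.mul (Real.continuous_sqrt.comp (hdc.comp continuous_fst))
  · have := hdet p.1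
    positivity

theorem GridFilter.ObservationModel.IsContinuous.likelihood_pos (hobs : obs.IsContinuous) (t : ℕ)
    (x : Fin M → ℝ) (y : EuclideanSpace ℝ (Fin N)) : 0 < obs.likelihood t x y := by
  have := (hobs.posDef t x).det_pos
  unfold ObservationModel.likelihood gaussianDensity
  positivity

theorem GridFilter.ObservationModel.IsContinuous.measurable_prod_likelihood (hobs : obs.IsContinuous) (n : ℕ) :
    Measurable fun p : (ℕ → Fin M → ℝ) × (Fin n → EuclideanSpace ℝ (Fin N)) =>
      ∏ s : Fin n, obs.likelihood s (p.1 (s + 1)) (p.2 s) := by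
  have hs : ∀ s : Fin n, Measurable
      fun p : (ℕ → Fin M → ℝ) × (Fin n → EuclideanSpace ℝ (Fin N)) =>
        obs.likelihood s (p.1 (s + 1)) (p.2 s) := fun s => by
    have e : Measurable fun p : (ℕ → Fin M → ℝ) × (Fin n → EuclideanSpace ℝ (Fin N)) =>
      (p.1 (s + 1), p.2 s) := by fun_prop
    have := (hobs.continuous_likelihood s).measurable.comp e
    exact this
  exact Finset.measurable_fun_prod _ fun s _ => hs s

/-- The joint law of the state process and of finitely many observations. -/
theorem map_state_observations_eq_withDensity (hobs : obs.IsContinuous)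
    {Ω : Type*} [MeasurableSpace Ω] {P : Measure Ω} [IsProbabilityMeasure P]
    {X : ℕ → Ω → Fin M → ℝ} (hX : ∀ n, Measurable (X n))
    {u Y : ℕ → Ω → EuclideanSpace ℝ (Fin N)} (hu : ∀ t, Measurable (u t))
    (huindep : iIndepFun u P)
    (hulaw : ∀ t, P.map (u t) = stdGaussian (EuclideanSpace ℝ (Fin N)))
    (hobserve : ∀ t, ∀ᵐ ω ∂P, Y t ω = obs.observe t (X (t + 1) ω) (u t ω))
    (hindep : IndepFun (fun ω n => X n ω) (fun ω t => u t ω) P) (n : ℕ) :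
    P.map (fun ω => ((fun k => X k ω), fun s : Fin n => Y s ω))
      = ((P.map fun ω k => X k ω).prod (Measure.pi fun _ : Fin n => refMeasure N)).withDensity
        fun p => ENNReal.ofReal (∏ s : Fin n, obs.likelihood s (p.1 (s + 1)) (p.2 s)) := by
  have hXm : Measurable fun ω k => X k ω := measurable_pi_iff.2 hX
  have hum : Measurable fun ω (s : Fin n) => u s ω := measurable_pi_lambda _ fun s => hu s
  have hQ : IsProbabilityMeasure (P.map fun ω k => X k ω) :=
    Measure.isProbabilityMeasure_map hXm.aemeasurable
  have hlaw : P.map (fun ω (s : Fin n) => u s ω)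
      = Measure.pi fun _ : Fin n => stdGaussian (EuclideanSpace ℝ (Fin N)) := by
    have h1 : iIndepFun (fun s : Fin n => u s) P := huindep.precomp Fin.val_injective
    rw [iIndepFun_iff_map_fun_eq_pi_map fun s : Fin n => (hu s).aemeasurable] at h1
    rw [h1]
    simp only [hulaw]
  have hjoint : P.map (fun ω => ((fun k => X k ω), fun s : Fin n => u s ω))
      = (P.map fun ω k => X k ω).prod
        (Measure.pi fun _ : Fin n => stdGaussian (EuclideanSpace ℝ (Fin N))) := by
    rw [← hlaw]
    refine (indepFun_iff_map_prod_eq_prod_map_map hXm.aemeasurable hum.aemeasurable).1 ?_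
    exact hindep.comp (φ := id) (ψ := fun (v : ℕ → EuclideanSpace ℝ (Fin N)) (s : Fin n) => v s)
      measurable_id (by fun_prop)
  have hobsm : ∀ t, Measurable fun p : (Fin M → ℝ) × EuclideanSpace ℝ (Fin N) =>
    obs.observe t p.1 p.2 := fun t => (hobs.continuous_observe t).measurable
  have hlikm : ∀ t, Measurable fun p : (Fin M → ℝ) × EuclideanSpace ℝ (Fin N) =>
    obs.likelihood t p.1 p.2 := fun t => (hobs.continuous_likelihood t).measurable
  -- T turns noise into observations. For a frozen path it acts on each noise vector separately, so
  -- the image of the product Gaussian is again a product, with the likelihoods as densities. The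
  -- state index is shifted: observation s sees the state with index s + 1.
  set T : (ℕ → Fin M → ℝ) × (Fin n → EuclideanSpace ℝ (Fin N)) →
      (ℕ → Fin M → ℝ) × (Fin n → EuclideanSpace ℝ (Fin N)) :=
    fun p => (p.1, fun s => obs.observe s (p.1 (s + 1)) (p.2 s)) with hT
  have hTm : Measurable T := by
    refine measurable_fst.prodMk (measurable_pi_iff.2 fun s => ?_)
    have e : Measurable fun p : (ℕ → Fin M → ℝ) × (Fin n → EuclideanSpace ℝ (Fin N)) =>
      (p.1 (s + 1), p.2 s) := by fun_prop
    exact (hobsm s).comp e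
  have hgm : Measurable fun p : (ℕ → Fin M → ℝ) × (Fin n → EuclideanSpace ℝ (Fin N)) =>
      ENNReal.ofReal (∏ s : Fin n, obs.likelihood s (p.1 (s + 1)) (p.2 s)) :=
     (hobs.measurable_prod_likelihood n).ennreal_ofReal
  have hYT : P.map (fun ω => ((fun k => X k ω), fun s : Fin n => Y s ω))
      = (P.map (fun ω => ((fun k => X k ω), fun s : Fin n => u s ω))).map T := by
    rw [Measure.map_map hTm (hXm.prodMk hum)]
    refine Measure.map_congr ?_
    filter_upwards [ae_all_iff.2 hobserve] with ω hω
    simp only [hT, Function.comp]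
    congr 1
    ext1 s
    exact hω s
  rw [hYT, hjoint]
  refine Measure.ext_of_lintegral _ fun F hF => ?_
  rw [lintegral_map hF hTm, lintegral_prod (fun p => F (T p)) (hF.comp hTm).aemeasurable,
    lintegral_withDensity_eq_lintegral_mul _ hgm hF, lintegral_prod _ (hgm.mul hF).aemeasurable]
  refine lintegral_congr fun x => ?_
  have hmx : ∀ s : Fin n, Measurable (obs.observe s (x (s + 1))) := fun s => by
    have e : Measurable fun y : EuclideanSpace ℝ (Fin N) => (x (s + 1), y) := by fun_prop
    have := (hobsm s).comp e
    exact this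
  have hlx : ∀ s : Fin n, Measurable fun y => obs.likelihood s (x (s + 1)) y := fun s => by
    have e : Measurable fun y : EuclideanSpace ℝ (Fin N) => (x (s + 1), y) := by fun_prop
    have := (hlikm s).comp e
    exact this
  have hprob : ∀ s : Fin n, IsProbabilityMeasure
      ((stdGaussian (EuclideanSpace ℝ (Fin N))).map (obs.observe s (x (s + 1)))) := fun s =>
    Measure.isProbabilityMeasure_map (hmx s).aemeasurable
  have hsf : ∀ s : Fin n, SigmaFinite ((refMeasure N).withDensity
      fun y => ENNReal.ofReal (obs.likelihood s (x (s + 1)) y)) := fun s => by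
    rw [← map_observe_eq_withDensity obs s _ (hobs.posDef _ _)]; infer_instance
  have hpi : (Measure.pi fun _ : Fin n => stdGaussian (EuclideanSpace ℝ (Fin N))).map
      (fun v (s : Fin n) => obs.observe s (x (s + 1)) (v s))
      = (Measure.pi fun _ : Fin n => refMeasure N).withDensity
        fun y => ∏ s : Fin n, ENNReal.ofReal (obs.likelihood s (x (s + 1)) (y s)) := by
    rw [Measure.pi_map_pi (fun s => (hmx s).aemeasurable)]
    simp only [fun s : Fin n => map_observe_eq_withDensity obs s (x (s + 1)) (hobs.posDef _ _)]
    exact pi_withDensity (fun _ : Fin n => refMeasure N)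
      (fun s y => ENNReal.ofReal (obs.likelihood s (x (s + 1)) y)) fun s => (hlx s).ennreal_ofReal
  have hmv : Measurable fun (v : Fin n → EuclideanSpace ℝ (Fin N)) (s : Fin n) =>
      obs.observe s (x (s + 1)) (v s) :=
    measurable_pi_lambda _ fun s => (hmx s).comp (measurable_pi_apply s)
  have hFx : Measurable fun y => F (x, y) := hF.comp measurable_prodMk_left
  have hprodm : Measurable fun y : Fin n → EuclideanSpace ℝ (Fin N) =>
      ∏ s : Fin n, ENNReal.ofReal (obs.likelihood s (x (s + 1)) (y s)) :=
    Finset.measurable_fun_prod _ fun s _ => ((hlx s).comp (measurable_pi_apply s)).ennreal_ofReal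
  calc _ = ∫⁻ y, F (x, y) ∂((Measure.pi fun _ : Fin n =>
        stdGaussian (EuclideanSpace ℝ (Fin N))).map
          (fun v (s : Fin n) => obs.observe s (x (s + 1)) (v s))) := (lintegral_map hFx hmv).symm
    _ = _ := by
      rw [hpi, lintegral_withDensity_eq_lintegral_mul _ hprodm hFx]
      refine lintegral_congr fun y => ?_
      simp only [Pi.mul_apply]
      rw [ENNReal.ofReal_prod_of_nonneg fun s _ => (hobs.likelihood_pos _ _ _).le]

/-- Conditioning on the past becomes conditioning on one random vector, as Bayes' formula for a pair
requires. -/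
theorem past_eq_comap {Ω E : Type*} [MeasurableSpace E] (Y : ℕ → Ω → E) (t : ℕ) :
    past Y t = MeasurableSpace.comap (fun ω (s : Fin (t + 1)) => Y s ω) inferInstance := by
  unfold past
  rw [show (inferInstance : MeasurableSpace (Fin (t + 1) → E)) = MeasurableSpace.pi from rfl,
    MeasurableSpace.pi, MeasurableSpace.comap_iSup]
  simp only [MeasurableSpace.comap_comp]
  refine le_antisymm (iSup₂_le fun i hi => ?_) (iSup_le fun s => ?_)
  · exact le_iSup (fun s : Fin (t + 1) => MeasurableSpace.comap
      ((fun b : Fin (t + 1) → E => b s) ∘ fun ω (s : Fin (t + 1)) => Y s ω) inferInstance)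
      ⟨i, Nat.lt_succ_of_le hi⟩
  · exact le_iSup₂_of_le (s : ℕ) (Nat.le_of_lt_succ s.2) le_rfl

/-- Bayes' formula for functions of the state given the observations up to time `t`. -/
theorem condExp_state_eq_ratio (hobs : obs.IsContinuous)
    {Ω : Type*} [MeasurableSpace Ω] {P : Measure Ω} [IsProbabilityMeasure P]
    {X : ℕ → Ω → Fin M → ℝ} (hX : ∀ n, Measurable (X n))
    {u Y : ℕ → Ω → EuclideanSpace ℝ (Fin N)} (hu : ∀ t, Measurable (u t))
    (huindep : iIndepFun u P)
    (hulaw : ∀ t, P.map (u t) = stdGaussian (EuclideanSpace ℝ (Fin N)))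
    (hY : ∀ t, Measurable (Y t))
    (hobserve : ∀ t, ∀ᵐ ω ∂P, Y t ω = obs.observe t (X (t + 1) ω) (u t ω))
    (hindep : IndepFun (fun ω n => X n ω) (fun ω t => u t ω) P)
    (hbdd : ∀ s y, ∃ B, ∀ x, obs.likelihood s x y ≤ B)
    {h : (Fin M → ℝ) → ℝ} (hh : Measurable h) {B : ℝ} (hhB : ∀ x, |h x| ≤ B) (t n : ℕ) :
    P[fun ω => h (X n ω) | past Y t] =ᵐ[P] fun ω =>
      (∫ ω', h (X n ω') * ∏ s ∈ Finset.range (t + 1), obs.likelihood s (X (s + 1) ω') (Y s ω) ∂P)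
        / ∫ ω', ∏ s ∈ Finset.range (t + 1), obs.likelihood s (X (s + 1) ω') (Y s ω) ∂P := by
  have hXm : Measurable fun ω k => X k ω := measurable_pi_iff.2 hX
  have hYm : Measurable fun ω (s : Fin (t + 1)) => Y s ω := measurable_pi_lambda _ fun s => hY s
  have hQ : IsProbabilityMeasure (P.map fun ω k => X k ω) :=
    Measure.isProbabilityMeasure_map hXm.aemeasurable
  have hgm := hobs.measurable_prod_likelihood (t + 1)
  have hgm' : ∀ y : Fin (t + 1) → EuclideanSpace ℝ (Fin N), Measurable fun x : ℕ → Fin M → ℝ =>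
      ∏ s : Fin (t + 1), obs.likelihood s (x (s + 1)) (y s) := fun y => by
    have e : Measurable fun x : ℕ → Fin M → ℝ => (x, y) := by fun_prop
    have := hgm.comp e
    exact this
  have hg0 : ∀ p : (ℕ → Fin M → ℝ) × (Fin (t + 1) → EuclideanSpace ℝ (Fin N)),
      0 ≤ ∏ s : Fin (t + 1), obs.likelihood s (p.1 (s + 1)) (p.2 s) := fun p =>
    Finset.prod_nonneg fun s _ => (hobs.likelihood_pos _ _ _).le
  have hgi : ∀ y : Fin (t + 1) → EuclideanSpace ℝ (Fin N),
      Integrable (fun x : ℕ → Fin M → ℝ =>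
        ∏ s : Fin (t + 1), obs.likelihood s (x (s + 1)) (y s)) (P.map fun ω k => X k ω) := by
    intro y
    choose D hD using fun s : Fin (t + 1) => hbdd s (y s)
    refine Integrable.of_bound (hgm' y).aestronglyMeasurable (∏ s, D s) (ae_of_all _ fun x => ?_)
    rw [Real.norm_of_nonneg (hg0 (x, y))]
    exact Finset.prod_le_prod (fun s _ => (hobs.likelihood_pos _ _ _).le) fun s _ => hD s _
  have hhn : Measurable fun x : ℕ → Fin M → ℝ => h (x n) := hh.comp (measurable_pi_apply n)
  have hlaw := map_state_observations_eq_withDensity hobs hX hu huindep hulaw hobserve hindep (t + 1)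
  have key := condExp_eq_ratio_of_map_eq_withDensity hXm hYm hgm hg0 hlaw hgi hhn
    (fun x => hhB (x n))
  rw [past_eq_comap]
  refine key.trans (ae_of_all _ fun ω => ?_)
  dsimp only
  rw [integral_map hXm.aemeasurable (hgm' _).aestronglyMeasurable,
    integral_map hXm.aemeasurable (f := fun x => h (x n) * ∏ s : Fin (t + 1),
      obs.likelihood s (x (s + 1)) (Y s ω)) (hhn.mul (hgm' _)).aestronglyMeasurable]
  simp only [Finset.prod_range]

end ContinuousModel

/-! ### Uniform limits of real functions -/

theorem tendstoUniformly_iff_abs_le {ι : Type*} {U : ℕ → ι → ℝ} {u : ι → ℝ} :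
    TendstoUniformly U u Filter.atTop ↔
      ∀ ε : ℝ, 0 < ε → ∃ k₀, ∀ k, k₀ ≤ k → ∀ i, |U k i - u i| ≤ ε := by
  rw [Metric.tendstoUniformly_iff]
  simp only [Filter.eventually_atTop, Real.dist_eq]
  refine ⟨fun h ε hε => ?_, fun h ε hε => ?_⟩
  · obtain ⟨k₀, hk⟩ := h ε hε
    exact ⟨k₀, fun k hkk i => by rw [abs_sub_comm]; exact (hk k hkk i).le⟩
  · obtain ⟨k₀, hk⟩ := h (ε / 2) (by positivity)
    exact ⟨k₀, fun k hkk i => by rw [abs_sub_comm]; linarith [hk k hkk i]⟩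

/-- Only the limits have to be bounded: capping the tolerance at 1 bounds V k by C + 1 from some
index on. -/
theorem TendstoUniformly.mul_of_bounded {ι : Type*} {U V : ℕ → ι → ℝ} {u v : ι → ℝ}
    (hU : TendstoUniformly U u Filter.atTop) (hV : TendstoUniformly V v Filter.atTop)
    {B C : ℝ} (hu : ∀ i, |u i| ≤ B) (hv : ∀ i, |v i| ≤ C) :
    TendstoUniformly (fun k i => U k i * V k i) (fun i => u i * v i) Filter.atTop := by
  rw [tendstoUniformly_iff_abs_le] at *
  intro ε hε
  set D := |B| + |C| + 1 with hD
  have hD0 : 0 < D := by positivity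
  obtain ⟨k₁, h₁⟩ := hU (min 1 (ε / (2 * D))) (by positivity)
  obtain ⟨k₂, h₂⟩ := hV (min 1 (ε / (2 * D))) (by positivity)
  refine ⟨max k₁ k₂, fun k hk i => ?_⟩
  have e1 := h₁ k (le_of_max_le_left hk) i
  have e2 := h₂ k (le_of_max_le_right hk) i
  have hVD : |V k i| ≤ D := by
    have := (abs_sub_abs_le_abs_sub (V k i) (v i)).trans (e2.trans (min_le_left _ _))
    have := hv i
    have := le_abs_self C
    have := abs_nonneg B
    linarith
  have huD : |u i| ≤ D := by
    have := hu i
    have := le_abs_self B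
    have := abs_nonneg C
    linarith
  have e1' := e1.trans (min_le_right _ _)
  have e2' := e2.trans (min_le_right _ _)
  calc |U k i * V k i - u i * v i| = |(U k i - u i) * V k i + u i * (V k i - v i)| := by ring_nf
    _ ≤ |U k i - u i| * |V k i| + |u i| * |V k i - v i| := by
        rw [← abs_mul, ← abs_mul]; exact abs_add_le _ _
    _ ≤ ε / (2 * D) * D + D * (ε / (2 * D)) := by gcongr
    _ = ε := by field_simp; ring

theorem TendstoUniformly.div_of_bounded {ι : Type*} {U V : ℕ → ι → ℝ} {u v : ι → ℝ}
    (hU : TendstoUniformly U u Filter.atTop) (hV : TendstoUniformly V v Filter.atTop)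
    {B c : ℝ} (hu : ∀ i, |u i| ≤ B) (hc : 0 < c) (hv : ∀ i, c ≤ v i) :
    TendstoUniformly (fun k i => U k i / V k i) (fun i => u i / v i) Filter.atTop := by
  have hinv : TendstoUniformly (fun k i => (V k i)⁻¹) (fun i => (v i)⁻¹) Filter.atTop := by
    rw [tendstoUniformly_iff_abs_le] at *
    intro ε hε
    -- The tolerance c / 2 keeps V k above c / 2; the other one absorbs the factor 1 / (V k · v) ≤ 2
    -- / c² of the difference of inverses.
    obtain ⟨k₀, h₀⟩ := hV (min (c / 2) (ε * (c * c / 2))) (by positivity)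
    refine ⟨k₀, fun k hk i => ?_⟩
    have e := h₀ k hk i
    have e1 := e.trans (min_le_left _ _)
    have e2 := e.trans (min_le_right _ _)
    have hvi := hv i
    have hVi : c / 2 ≤ V k i := by linarith [(abs_le.1 e1).1]
    have hV0 : 0 < V k i := by linarith
    have hv0 : 0 < v i := by linarith
    rw [inv_sub_inv hV0.ne' hv0.ne', abs_div, abs_of_pos (mul_pos hV0 hv0), div_le_iff₀ (by positivity),
      abs_sub_comm]
    refine e2.trans (mul_le_mul_of_nonneg_left ?_ hε.le)
    calc c * c / 2 = c / 2 * c := by ring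
      _ ≤ V k i * v i := by gcongr
  simp only [div_eq_mul_inv]
  refine hU.mul_of_bounded hinv hu (C := c⁻¹) fun i => ?_
  have : 0 < v i := hc.trans_le (hv i)
  rw [abs_of_pos (inv_pos.2 this)]
  exact inv_anti₀ hc (hv i)

theorem tendstoUniformly_prod_of_bounded {ι : Type*} {U : ℕ → ℕ → ι → ℝ} {u : ℕ → ι → ℝ}
    (hU : ∀ s, TendstoUniformly (U s) (u s) Filter.atTop) (hu : ∀ s, ∃ B, ∀ i, |u s i| ≤ B) (n : ℕ) :
    TendstoUniformly (fun k i => ∏ s ∈ Finset.range n, U s k i)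
      (fun i => ∏ s ∈ Finset.range n, u s i) Filter.atTop := by
  choose B hB using hu
  induction n with
  | zero =>
    rw [tendstoUniformly_iff_abs_le]
    exact fun ε hε => ⟨0, fun k _ i => by simpa using hε.le⟩
  | succ n ih =>
    simp only [Finset.prod_range_succ]
    refine ih.mul_of_bounded (hU n) (B := ∏ s ∈ Finset.range n, B s) (fun i => ?_) (hB n)
    rw [Finset.abs_prod]
    exact Finset.prod_le_prod (fun _ _ => abs_nonneg _) fun s _ => hB s i

/-! ### Geometry of the uniform grid -/

section Grid

variable {M : ℕ} {a b : ℝ}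

theorem dist_le_l1 {ι : Type*} [Fintype ι] (x y : ι → ℝ) : dist x y ≤ l1 (x - y) := by
  refine (dist_pi_le_iff (Finset.sum_nonneg fun i _ => abs_nonneg _)).2 fun i => ?_
  rw [Real.dist_eq]
  exact Finset.single_le_sum (f := fun i => |(x - y) i|) (fun i _ => abs_nonneg _) (Finset.mem_univ i)

theorem l1_le_of_forall_abs_le {ι : Type*} [Fintype ι] {v : ι → ℝ} {c : ℝ} (h : ∀ i, |v i| ≤ c) :
    l1 v ≤ Fintype.card ι * c := by
  refine (Finset.sum_le_sum fun i _ => h i).trans ?_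
  simp

theorem l1_add_le {ι : Type*} [Fintype ι] (v w : ι → ℝ) : l1 (v + w) ≤ l1 v + l1 w := by
  unfold l1
  rw [← Finset.sum_add_distrib]
  exact Finset.sum_le_sum fun i _ => abs_add_le _ _

theorem l1_nonneg {ι : Type*} [Fintype ι] (v : ι → ℝ) : 0 ≤ l1 v :=
  Finset.sum_nonneg fun _ _ => abs_nonneg _

theorem abs_center_cellIndex_sub_le (hab : a < b) (L : ℕ) [NeZero L] {x : Fin M → ℝ}
    (hx : x ∈ box M a b) (m : Fin M) :
    |center a b L (cellIndex a b L x) m - x m| ≤ (b - a) / L := by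
  have hL : (0 : ℝ) < L := Nat.cast_pos.2 (NeZero.pos L)
  have hba : 0 < b - a := sub_pos.2 hab
  have hxa : a ≤ x m := hx.1 m
  have hxb : x m ≤ b := hx.2 m
  set r := (x m - a) / (b - a) * L with hr
  have hr0 : 0 ≤ r := by have : 0 ≤ x m - a := by linarith
                         positivity
  have hrL : r ≤ L := by
    have : (x m - a) / (b - a) ≤ 1 := by rw [div_le_one hba]; linarith
    nlinarith
  have hxr : x m = a + r * ((b - a) / L) := by rw [hr]; field_simp; ring
  set i := min ⌊r⌋₊ (L - 1) with hi
  have hc : center a b L (cellIndex a b L x) m = a + ((i : ℝ) + 1 / 2) * ((b - a) / L) := rfl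
  -- In units of the mesh, r is the position of the point and i + 1/2 that of the center. The cap L
  -- - 1 matters at r = L, the right end point of the cube.
  have key : |(i : ℝ) + 1 / 2 - r| ≤ 1 := by
    have hfl := Nat.floor_le hr0
    have hlt := Nat.lt_floor_add_one r
    rcases le_total ⌊r⌋₊ (L - 1) with h | h
    · rw [hi, min_eq_left h, abs_le]
      constructor <;> linarith
    · rw [hi, min_eq_right h, Nat.cast_sub (NeZero.one_le), Nat.cast_one, abs_le]
      have : ((L - 1 : ℕ) : ℝ) ≤ ⌊r⌋₊ := by exact_mod_cast h
      rw [Nat.cast_sub (NeZero.one_le), Nat.cast_one] at this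
      constructor <;> linarith
  rw [hc, hxr, show a + ((i : ℝ) + 1 / 2) * ((b - a) / L) - (a + r * ((b - a) / L))
    = ((i : ℝ) + 1 / 2 - r) * ((b - a) / L) by ring, abs_mul, abs_of_pos (div_pos hba hL)]
  have : 0 < (b - a) / L := div_pos hba hL
  nlinarith

theorem dist_center_cellIndex_le (hab : a < b) (L : ℕ) [NeZero L] {x : Fin M → ℝ}
    (hx : x ∈ box M a b) : dist (center a b L (cellIndex a b L x)) x ≤ (b - a) / L := by
  have hba : 0 < b - a := sub_pos.2 hab
  exact (dist_pi_le_iff (by positivity)).2 fun m => abs_center_cellIndex_sub_le hab L hx m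

theorem l1_center_cellIndex_le (hab : a < b) (L : ℕ) [NeZero L] {x : Fin M → ℝ}
    (hx : x ∈ box M a b) : l1 (center a b L (cellIndex a b L x) - x) ≤ M * (b - a) / L := by
  refine (l1_le_of_forall_abs_le fun m => abs_center_cellIndex_sub_le hab L hx m).trans ?_
  rw [Fintype.card_fin, mul_div_assoc]

theorem center_mem_box (hab : a < b) (L : ℕ) [NeZero L] (l : Grid M L) :
    center a b L l ∈ box M a b := by
  have hL : (0 : ℝ) < L := Nat.cast_pos.2 (NeZero.pos L)
  have hba : 0 < b - a := sub_pos.2 hab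
  have hh : 0 < (b - a) / L := div_pos hba hL
  have hlt : ∀ m, ((l m : ℕ) : ℝ) + 1 ≤ L := fun m => by exact_mod_cast (l m).2
  have hLh : L * ((b - a) / L) = b - a := by field_simp
  refine ⟨fun m => ?_, fun m => ?_⟩ <;> simp only [center]
  · have : 0 ≤ ((l m : ℕ) + 1 / 2 : ℝ) * ((b - a) / L) := by positivity
    linarith
  · have : ((l m : ℕ) + 1 / 2 : ℝ) * ((b - a) / L) ≤ L * ((b - a) / L) :=
      mul_le_mul_of_nonneg_right (by linarith [hlt m]) hh.le
    linarith

theorem measurable_cellIndex (L : ℕ) [NeZero L] : Measurable (cellIndex (M := M) a b L) := by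
  refine measurable_pi_lambda _ fun m => ?_
  have h1 : Measurable fun n : ℕ => (⟨min n (L - 1), lt_of_le_of_lt (min_le_right _ _)
    (Nat.sub_lt (NeZero.pos L) Nat.one_pos)⟩ : Fin L) := measurable_of_countable _
  have h2 : Measurable fun x : Fin M → ℝ => ⌊(x m - a) / (b - a) * L⌋₊ :=
    Nat.measurable_floor.comp (by fun_prop)
  exact h1.comp h2

theorem measurableSet_box : MeasurableSet (box M a b) := measurableSet_Icc

theorem measurableSet_cell (L : ℕ) [NeZero L] (l : Grid M L) : MeasurableSet (cell a b L l) :=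
  measurableSet_box.inter (measurable_cellIndex L (measurableSet_singleton l))

/-- A bounded family of continuous functions that is uniformly equicontinuous on the cube. -/
structure TameFamily {Θ : Type*} (a b : ℝ) (F : Θ → (Fin M → ℝ) → ℝ) : Prop where
  continuous : ∀ θ, Continuous (F θ)
  bounded : ∃ B, ∀ θ x, |F θ x| ≤ B
  equicontinuous : ∀ ε : ℝ, 0 < ε → ∃ δ : ℝ, 0 < δ ∧ ∀ θ, ∀ x ∈ box M a b, ∀ x' ∈ box M a b,
    dist x x' ≤ δ → |F θ x - F θ x'| ≤ ε

/-- Equicontinuity does not depend on the parameter, so the index may combine a parameter with a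
sample point or a point of the cube; the result is uniform in both. -/
theorem TameFamily.tendstoUniformly_comp {Θ ι : Type*} {F : Θ → (Fin M → ℝ) → ℝ}
    (hF : TameFamily a b F) (τ : ι → Θ) {p : ℕ → ι → Fin M → ℝ} {q : ι → Fin M → ℝ}
    (hp : ∀ k i, p k i ∈ box M a b) (hq : ∀ i, q i ∈ box M a b) {e : ℕ → ℝ}
    (he : Filter.Tendsto e Filter.atTop (nhds 0)) (hpq : ∀ k i, dist (p k i) (q i) ≤ e k) :
    TendstoUniformly (fun k i => F (τ i) (p k i)) (fun i => F (τ i) (q i)) Filter.atTop := by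
  rw [tendstoUniformly_iff_abs_le]
  intro ε hε
  obtain ⟨δ, hδ, h⟩ := hF.equicontinuous ε hε
  obtain ⟨k₀, hk₀⟩ := Filter.eventually_atTop.1 (he.eventually_lt_const hδ)
  exact ⟨k₀, fun k hk i => h _ _ (hp k i) _ (hq i) ((hpq k i).trans (hk₀ k hk).le)⟩

theorem tendsto_const_div_add_one (c : ℝ) :
    Filter.Tendsto (fun k : ℕ => c / ((k + 1 : ℕ) : ℝ)) Filter.atTop (nhds 0) :=
  (tendsto_const_div_atTop_nhds_zero_nat c).comp (Filter.tendsto_add_atTop_nat 1)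

/-! ### Filters with general weights -/

/-- The filter recursion `A_{n+1} = diag(g_n) P A_n` with arbitrary weights `g`. -/
def weightedFilter {ι : Type*} [Fintype ι] (Pm : Matrix ι ι ℝ) (A : ι → ℝ) (g : ℕ → ι → ℝ) :
    ℕ → ι → ℝ
  | 0 => A
  | n + 1 => fun l => g n l * Pm.mulVec (weightedFilter Pm A g n) l

theorem weightedFilter_nonneg {ι : Type*} [Fintype ι] {Pm : Matrix ι ι ℝ} {A : ι → ℝ}
    {g : ℕ → ι → ℝ} (hP : ∀ i j, 0 ≤ Pm i j) (hA : ∀ i, 0 ≤ A i) (hg : ∀ n i, 0 ≤ g n i) (n : ℕ)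
    (i : ι) : 0 ≤ weightedFilter Pm A g n i := by
  induction n generalizing i with
  | zero => exact hA i
  | succ n ih => exact mul_nonneg (hg n i) (Finset.sum_nonneg fun j _ => mul_nonneg (hP i j) (ih j))

theorem unnormalizedFilter_eq_weightedFilter {N : ℕ} (obs : ObservationModel M N) (L : ℕ)
    (Pm : Matrix (Grid M L) (Grid M L) ℝ) (A : Grid M L → ℝ) (y : ℕ → EuclideanSpace ℝ (Fin N))
    (n : ℕ) : unnormalizedFilter obs a b L Pm A y n
      = weightedFilter Pm A (fun s l => obs.likelihood s (center a b L l) (y s)) n := by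
  induction n with
  | zero => rfl
  | succ n ih =>
    ext l
    simp only [unnormalizedFilter, weightedFilter, ih, likelihoodMatrix, Matrix.mulVec_diagonal]

theorem weightedFilter_congr {ι : Type*} [Fintype ι] (Pm : Matrix ι ι ℝ) (A : ι → ℝ)
    {g g' : ℕ → ι → ℝ} {n : ℕ} (h : ∀ s < n, g s = g' s) :
    weightedFilter Pm A g n = weightedFilter Pm A g' n := by
  induction n with
  | zero => rfl
  | succ n ih =>
    ext l
    simp only [weightedFilter, ih fun s hs => h s (hs.trans n.lt_succ_self), h n n.lt_succ_self]

/-- A prediction step is a filter step with weight 1, so predictions need no separate limit theorem.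
-/
theorem pow_mulVec_weightedFilter {ι : Type*} [Fintype ι] [DecidableEq ι] (Pm : Matrix ι ι ℝ)
    (A : ι → ℝ) (g : ℕ → ι → ℝ) (n r : ℕ) :
    (Pm ^ r).mulVec (weightedFilter Pm A g n)
      = weightedFilter Pm A (fun s l => if s < n then g s l else 1) (n + r) := by
  induction r with
  | zero =>
    simp only [pow_zero, Matrix.one_mulVec, add_zero]
    exact weightedFilter_congr Pm A fun s hs => by simp [hs]
  | succ r ih =>
    rw [pow_succ', ← Matrix.mulVec_mulVec, ih, ← add_assoc]
    ext l
    simp [weightedFilter]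

/-- Along the grids, filters with general weights converge to the expectations over the paths of
the state, uniformly over tame families of weights. -/
def FilterConsistent.{u} {Ω : Type u} [MeasurableSpace Ω] (P : Measure Ω) (a b : ℝ)
    (X : ℕ → Ω → Fin M → ℝ) (Pm : ∀ (L : ℕ) [NeZero L], Matrix (Grid M L) (Grid M L) ℝ) : Prop :=
  ∀ (Θ : Type u) (g : ℕ → Θ → (Fin M → ℝ) → ℝ) (F : Θ → (Fin M → ℝ) → ℝ),
    (∀ s, TameFamily a b (g s)) → TameFamily a b F → ∀ n,
    TendstoUniformly (fun (k : ℕ) θ => ∑ l, F θ (center a b (k + 1) l) *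
        weightedFilter (Pm (k + 1)) (initialVector P a b (X 0) (k + 1))
          (fun s l => g s θ (center a b (k + 1) l)) n l)
      (fun θ => ∫ ω, F θ (X n ω) * ∏ s ∈ Finset.range n, g s θ (X (s + 1) ω) ∂P) Filter.atTop

/-! ### Integrals of functions of a label -/

theorem integral_comp_mul_eq_sum {Ω ι : Type*} [MeasurableSpace Ω] {P : Measure Ω} [Fintype ι]
    [MeasurableSpace ι] [MeasurableSingletonClass ι] {J : Ω → ι} (hJ : Measurable J)
    (V : ι → ℝ) {H : Ω → ℝ} (hH : Integrable H P) :
    ∫ ω, V (J ω) * H ω ∂P = ∑ l, V l * ∫ ω in J ⁻¹' {l}, H ω ∂P := by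
  have h1 : ∀ ω, V (J ω) * H ω = ∑ l, (J ⁻¹' {l}).indicator (fun ω => V l * H ω) ω := by
    intro ω
    rw [Finset.sum_eq_single (J ω)]
    · simp
    · intro l _ hl
      exact Set.indicator_of_notMem (fun h => hl h.symm) _
    · simp
  have hm : ∀ l, MeasurableSet (J ⁻¹' {l}) := fun l => hJ (measurableSet_singleton l)
  simp only [h1]
  rw [integral_finsetSum _ fun l _ => (hH.const_mul (V l)).indicator (hm l)]
  refine Finset.sum_congr rfl fun l _ => ?_
  rw [integral_indicator (hm l), integral_const_mul]

end Grid

/-! ### Markovian quantization -/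

/-- The two hypotheses make the law of the triple a product of three measures, and such a product
can be reassociated. -/
theorem ProbabilityTheory.IndepFun.prodMk_left_of_prodMk_right {Ω α β γ : Type*} [MeasurableSpace Ω]
    [MeasurableSpace α] [MeasurableSpace β] [MeasurableSpace γ] {P : Measure Ω}
    [IsProbabilityMeasure P] {A : Ω → α} {B : Ω → β} {C : Ω → γ} (hA : Measurable A)
    (hB : Measurable B) (hC : Measurable C) (h : IndepFun A (fun ω => (B ω, C ω)) P)
    (hBC : IndepFun B C P) : IndepFun (fun ω => (A ω, B ω)) C P := by
  have hpA := Measure.isProbabilityMeasure_map (μ := P) hA.aemeasurable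
  have hpB := Measure.isProbabilityMeasure_map (μ := P) hB.aemeasurable
  have hpC := Measure.isProbabilityMeasure_map (μ := P) hC.aemeasurable
  have hAB : IndepFun A B P := h.comp measurable_id measurable_fst
  rw [indepFun_iff_map_prod_eq_prod_map_map hA.aemeasurable (hB.prodMk hC).aemeasurable,
    (indepFun_iff_map_prod_eq_prod_map_map hB.aemeasurable hC.aemeasurable).1 hBC] at h
  rw [indepFun_iff_map_prod_eq_prod_map_map (hA.prodMk hB).aemeasurable hC.aemeasurable,
    (indepFun_iff_map_prod_eq_prod_map_map hA.aemeasurable hB.aemeasurable).1 hAB]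
  have h2 := congrArg (Measure.map (MeasurableEquiv.prodAssoc (α := α) (β := β) (γ := γ)).symm) h
  rw [Measure.map_map (MeasurableEquiv.measurable _) (hA.prodMk (hB.prodMk hC)),
    ← Measure.prodAssoc_prod, Measure.map_map (MeasurableEquiv.measurable _)
      (MeasurableEquiv.measurable _)] at h2
  simpa [Function.comp_def, MeasurableEquiv.prodAssoc] using h2

section Markovian

variable {M k : ℕ} {a b : ℝ}

/-- The chain of labels `𝒬(f(·, w))` driven by `w`, started in the cell of `x`. -/
noncomputable def quantizedChain (a b : ℝ) (L : ℕ) [NeZero L] (f : (Fin M → ℝ) → (Fin k → ℝ) → Fin M → ℝ)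
    (x : Fin M → ℝ) (w : ℕ → Fin k → ℝ) : ℕ → Grid M L
  | 0 => cellIndex a b L x
  | n + 1 => cellIndex a b L (f (center a b L (quantizedChain a b L f x w n)) (w n))

/-- The σ-algebra is arbitrary and only the inputs before n have to be measurable: this is how the
chain up to n is seen to depend only on the initial state and the inputs before W n. -/
theorem measurable_quantizedChain {Ω : Type*} {m : MeasurableSpace Ω} (L : ℕ) [NeZero L]
    {f : (Fin M → ℝ) → (Fin k → ℝ) → Fin M → ℝ} (hf : Measurable (Function.uncurry f))
    {x : Ω → Fin M → ℝ} (hx : Measurable x) {w : ℕ → Ω → Fin k → ℝ} (n : ℕ)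
    (hw : ∀ i < n, Measurable (w i)) :
    Measurable fun ω => quantizedChain a b L f (x ω) (fun t => w t ω) n := by
  induction n with
  | zero => exact (measurable_cellIndex L).comp hx
  | succ n ih =>
    have h1 : Measurable fun ω =>
        center a b L (quantizedChain a b L f (x ω) (fun t => w t ω) n) :=
      (measurable_of_countable (center a b L)).comp (ih fun i hi => hw i (hi.trans n.lt_succ_self))
    exact (measurable_cellIndex L).comp (hf.comp (h1.prodMk (hw n n.lt_succ_self)))

variable {Ω E : Type*} [MeasurableSpace Ω] [MeasurableSpace E] {P : Measure Ω}
  [IsProbabilityMeasure P] {X : ℕ → Ω → Fin M → ℝ} {u : ℕ → Ω → E} {S : Set (Fin k → ℝ)}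
  {f : (Fin M → ℝ) → (Fin k → ℝ) → Fin M → ℝ} {W : ℕ → Ω → Fin k → ℝ}

-- Iterating f expresses every state almost surely as a measurable function of the initial state and
-- of W, and this pair is independent of the observation noise.
omit [IsProbabilityMeasure P] in
theorem GridFilter.MarkovianSetting.indepFun_states (h : MarkovianSetting P a b X u S f W) :
    IndepFun (fun ω n => X n ω) (fun ω t => u t ω) P := by
  let G : ℕ → (Fin M → ℝ) × (ℕ → Fin k → ℝ) → Fin M → ℝ := fun n =>
    n.rec (fun p => p.1) fun m r p => f (r p) (p.2 m)
  have hG : ∀ n, Measurable (G n) := by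
    intro n
    induction n with
    | zero => exact measurable_fst
    | succ n ih =>
      exact h.measurable_f.comp (ih.prodMk ((measurable_pi_apply n).comp measurable_snd))
  have hind := h.indep_noise.comp (φ := fun p n => G n p) (ψ := id)
    (measurable_pi_lambda _ hG) measurable_id
  refine hind.congr ?_ Filter.EventuallyEq.rfl
  filter_upwards [ae_all_iff.2 h.transition] with ω hω
  ext1 n
  change G n (X 0 ω, fun t => W t ω) = X n ω
  induction n with
  | zero => rfl
  | succ n ih =>
    rw [hω n, ← ih]

theorem GridFilter.MarkovianSetting.indepFun_history (h : MarkovianSetting P a b X u S f W)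
    (hX : Measurable (X 0)) (n : ℕ) :
    IndepFun (fun ω => (X 0 ω, fun i : Finset.range n => W i ω)) (W n) P := by
  have hWn : Measurable fun ω (i : Finset.range n) => W i ω :=
    measurable_pi_lambda _ fun i => h.measurable_W i
  refine IndepFun.prodMk_left_of_prodMk_right hX hWn (h.measurable_W n) ?_ ?_
  · exact h.indep_init.comp (φ := id)
      (ψ := fun w : ℕ → Fin k → ℝ => ((fun i : Finset.range n => w i), w n))
      measurable_id (by fun_prop)
  · have h1 := h.W_indep.indepFun_finset (Finset.range n) {n} (by simp) h.measurable_W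
    exact h1.comp (φ := id)
      (ψ := fun w : ({n} : Finset ℕ) → Fin k → ℝ => w ⟨n, Finset.mem_singleton_self n⟩)
      measurable_id (measurable_pi_apply _)

omit [IsProbabilityMeasure P] in
theorem GridFilter.MarkovianSetting.markovianTransition_apply (hab : a < b)
    (h : MarkovianSetting P a b X u S f W) (L : ℕ) [NeZero L] (n : ℕ) (i j : Grid M L) :
    markovianTransition (P.map (W 0)) a b f L i j
      = P.real {ω | cellIndex a b L (f (center a b L j) (W n ω)) = i} := by
  have hfj : Measurable (f (center a b L j)) := h.measurable_f.comp measurable_prodMk_left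
  have h1 : MeasurableSet {w | f (center a b L j) w ∈ cell a b L i} :=
    hfj (measurableSet_cell L i)
  rw [← (h.W_identDistrib n).map_eq]
  change (P.map (W n)).real _ = _
  rw [map_measureReal_apply (h.measurable_W n) h1]
  refine measureReal_congr ?_
  filter_upwards [h.W_mem n] with ω hω
  refine propext ⟨fun hc => hc.2, fun hc => ⟨h.maps_box _ hω _ (center_mem_box hab L j), hc⟩⟩

/-- A Feynman–Kac formula. In the induction step W n is independent of the chain up to n, so passing
from label j to label l contributes exactly the factor P(l, j). -/
theorem GridFilter.MarkovianSetting.weightedFilter_eq (hab : a < b)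
    (h : MarkovianSetting P a b X u S f W) (hX : Measurable (X 0))
    (hXbox : ∀ᵐ ω ∂P, X 0 ω ∈ box M a b) (L : ℕ) [NeZero L] (g : ℕ → Grid M L → ℝ) (n : ℕ)
    (l : Grid M L) :
    weightedFilter (markovianTransition (P.map (W 0)) a b f L) (initialVector P a b (X 0) L) g n l
      = ∫ ω in (fun ω => quantizedChain a b L f (X 0 ω) (fun t => W t ω) n) ⁻¹' {l},
        ∏ s ∈ Finset.range n,
          g s (quantizedChain a b L f (X 0 ω) (fun t => W t ω) (s + 1)) ∂P := by
  set J : ℕ → Ω → Grid M L := fun n ω => quantizedChain a b L f (X 0 ω) (fun t => W t ω) n with hJ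
  have hJm : ∀ n, Measurable (J n) := fun n =>
    measurable_quantizedChain L h.measurable_f hX n fun i _ => h.measurable_W i
  set H : ℕ → Ω → ℝ := fun n ω => ∏ s ∈ Finset.range n, g s (J (s + 1) ω) with hH
  change _ = ∫ ω in J n ⁻¹' {l}, H n ω ∂P
  induction n generalizing l with
  | zero =>
    simp only [weightedFilter, hH, initialVector, Finset.range_zero, Finset.prod_empty,
      integral_const, smul_eq_mul, mul_one, measureReal_restrict_apply MeasurableSet.univ,
      Set.univ_inter]
    refine measureReal_congr ?_
    filter_upwards [hXbox] with ω hω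
    exact propext ⟨fun hc => hc.2, fun hc => ⟨hω, hc⟩⟩
  | succ n ih =>
    have hbound : ∀ ω, ‖H n ω‖ ≤ ∏ s ∈ Finset.range n, ∑ i, |g s i| := fun ω => by
      rw [Real.norm_eq_abs, hH, Finset.abs_prod]
      exact Finset.prod_le_prod (fun _ _ => abs_nonneg _) fun s _ =>
        Finset.single_le_sum (f := fun i => |g s i|) (fun _ _ => abs_nonneg _) (Finset.mem_univ _)
    have hHm : Measurable (H n) := Finset.measurable_fun_prod _ fun s _ =>
      (measurable_of_countable (g s)).comp (hJm (s + 1))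
    have hHint : Integrable (H n) P :=
      Integrable.of_bound hHm.aestronglyMeasurable _ (ae_of_all _ hbound)
    have hset : ∀ m l, MeasurableSet (J m ⁻¹' {l}) := fun m l => hJm m (measurableSet_singleton l)
    have hstep : ∫ ω in J (n + 1) ⁻¹' {l}, H (n + 1) ω ∂P
        = g n l * ∫ ω in J (n + 1) ⁻¹' {l}, H n ω ∂P := by
      rw [← integral_const_mul]
      refine setIntegral_congr_fun (hset _ _) fun ω hω => ?_
      have hω' : J (n + 1) ω = l := hω
      simp only [hH, Finset.prod_range_succ, hω', mul_comm]
    rw [hstep]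
    simp only [weightedFilter, Matrix.mulVec, dotProduct, ih]
    congr 1
    set Un : Grid M L → (Fin k → ℝ) → ℝ := fun j =>
      Set.indicator {w | cellIndex a b L (f (center a b L j) w) = l} 1 with hUn
    have hUset : ∀ j, MeasurableSet {w | cellIndex a b L (f (center a b L j) w) = l} := fun j =>
      ((measurable_cellIndex L).comp (h.measurable_f.comp measurable_prodMk_left))
        (measurableSet_singleton l)
    -- Split according to the label j at step n: the first factor is determined by the history, the
    -- second by W n.
    have hdecomp : ∀ ω, (J (n + 1) ⁻¹' {l}).indicator (H n) ω
        = ∑ j, (J n ⁻¹' {j}).indicator (H n) ω * Un j (W n ω) := by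
      intro ω
      rw [Finset.sum_eq_single (J n ω)]
      · rw [Set.indicator_of_mem (show ω ∈ J n ⁻¹' {J n ω} from rfl)]
        by_cases hc : J (n + 1) ω = l
        · have hc' : cellIndex a b L (f (center a b L (J n ω)) (W n ω)) = l := hc
          simp [hUn, hc, hc']
        · have hc' : ¬ cellIndex a b L (f (center a b L (J n ω)) (W n ω)) = l := hc
          simp [hUn, hc, hc']
      · intro j _ hj
        rw [Set.indicator_of_notMem (fun hc => hj hc.symm), zero_mul]
      · simp
    have hUm : ∀ j, Measurable (Un j) := fun j => measurable_one.indicator (hUset j)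
    have hUle : ∀ j w, ‖Un j w‖ ≤ 1 := fun j w => by
      rw [hUn, Real.norm_eq_abs]
      simp only [Set.indicator_apply]
      split_ifs <;> simp
    have hindep : ∀ j, IndepFun ((J n ⁻¹' {j}).indicator (H n)) (fun ω => Un j (W n ω)) P := by
      intro j
      have hh := h.indepFun_history hX n
      rw [IndepFun_iff_Indep] at hh ⊢
      set tup : Ω → (Fin M → ℝ) × (Finset.range n → Fin k → ℝ) :=
        fun ω => (X 0 ω, fun i : Finset.range n => W i ω) with htup
      have htm : Measurable[MeasurableSpace.comap tup inferInstance] tup := comap_measurable tup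
      have hX0 : Measurable[MeasurableSpace.comap tup inferInstance] (X 0) :=
        measurable_fst.comp htm
      have hWi : ∀ i < n, Measurable[MeasurableSpace.comap tup inferInstance] (W i) := fun i hi =>
        (measurable_pi_apply (⟨i, Finset.mem_range.2 hi⟩ : Finset.range n)).comp
          (measurable_snd.comp htm)
      have hJt : ∀ i ≤ n, Measurable[MeasurableSpace.comap tup inferInstance] (J i) := fun i hi =>
        measurable_quantizedChain (m := MeasurableSpace.comap tup inferInstance) L h.measurable_f
          hX0 i fun s hs => hWi s (hs.trans_le hi)
      have hHt : Measurable[MeasurableSpace.comap tup inferInstance] (H n) :=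
        @Finset.measurable_fun_prod _ _ _ _ _ _ (MeasurableSpace.comap tup inferInstance) _ _
          fun s hs => (measurable_of_countable (g s)).comp
            (hJt (s + 1) (Nat.succ_le_of_lt (Finset.mem_range.1 hs)))
      have hVt : Measurable[MeasurableSpace.comap tup inferInstance]
          ((J n ⁻¹' {j}).indicator (H n)) :=
        hHt.indicator (hJt n le_rfl (measurableSet_singleton j))
      refine indep_of_indep_of_le_left (indep_of_indep_of_le_right hh ?_) hVt.comap_le
      rw [show (fun ω => Un j (W n ω)) = Un j ∘ W n from rfl, ← MeasurableSpace.comap_comp]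
      exact MeasurableSpace.comap_mono (hUm j).comap_le
    rw [← integral_indicator (hset _ _)]
    simp only [hdecomp]
    rw [integral_finsetSum]
    · refine Finset.sum_congr rfl fun j _ => ?_
      rw [(hindep j).integral_fun_mul_eq_mul_integral
        (hHm.indicator (hset n j)).aestronglyMeasurable
        ((hUm j).comp (h.measurable_W n)).aestronglyMeasurable, integral_indicator (hset n j),
        mul_comm, h.markovianTransition_apply hab L n]
      congr 1
      have : (fun ω => Un j (W n ω))
          = Set.indicator {ω | cellIndex a b L (f (center a b L j) (W n ω)) = l} 1 := rfl
      rw [this]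
      exact (integral_indicator_one (h.measurable_W n (hUset j))).symm
    · intro j _
      exact (hHint.indicator (hset n j)).mul_of_top_left
        (MemLp.of_bound ((hUm j).comp (h.measurable_W n)).aestronglyMeasurable 1
          (ae_of_all _ fun ω => hUle j _))

-- Each step adds a rounding error of at most M(b - a)/L and multiplies the earlier error by at most
-- the bound of the Lipschitz constants. The resulting D depends on n, but not on L or ω.
omit [IsProbabilityMeasure P] in
theorem GridFilter.MarkovianSetting.l1_quantizedChain_sub_le (hab : a < b)
    (h : MarkovianSetting P a b X u S f W) (n : ℕ) :
    ∃ D : ℝ, ∀ (L : ℕ) [NeZero L] (ω : Ω), (∀ n, X (n + 1) ω = f (X n ω) (W n ω)) →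
      (∀ n, X n ω ∈ box M a b) → (∀ n, W n ω ∈ S) →
      l1 (center a b L (quantizedChain a b L f (X 0 ω) (fun t => W t ω) n) - X n ω) ≤ D / L := by
  obtain ⟨K, hK0, ⟨Kb, hKb⟩, hK⟩ := h.lipschitz
  induction n with
  | zero => exact ⟨M * (b - a), fun L _ ω _ hbox _ => l1_center_cellIndex_le hab L (hbox 0)⟩
  | succ n ih =>
    obtain ⟨D, hD⟩ := ih
    refine ⟨M * (b - a) + Kb * D, fun L _ ω htr hbox hW => ?_⟩
    have hc := center_mem_box hab L (quantizedChain a b L f (X 0 ω) (fun t => W t ω) n)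
    set c := center a b L (quantizedChain a b L f (X 0 ω) (fun t => W t ω) n) with hcdef
    have hKw : K (W n ω) ≤ Kb := hKb ⟨_, hW n, rfl⟩
    have hKw0 := hK0 _ (hW n)
    have e1 := l1_center_cellIndex_le hab L (h.maps_box _ (hW n) _ hc)
    have e2 := hK _ (hW n) _ hc _ (hbox n)
    have e3 := hD L ω htr hbox hW
    have e4 : K (W n ω) * l1 (c - X n ω) ≤ Kb * (D / L) :=
      mul_le_mul hKw e3 (l1_nonneg _) (hKw0.trans hKw)
    rw [htr n]
    calc l1 (center a b L (cellIndex a b L (f c (W n ω))) - f (X n ω) (W n ω))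
        = l1 ((center a b L (cellIndex a b L (f c (W n ω))) - f c (W n ω))
          + (f c (W n ω) - f (X n ω) (W n ω))) := by congr 1; abel
      _ ≤ M * (b - a) / L + Kb * (D / L) :=
        (l1_add_le _ _).trans (add_le_add e1 (e2.trans e4))
      _ = _ := by ring

/-- By the Feynman–Kac formula the sum over the grid is an expectation on the original space. Chain
and state share the inputs W, so the two integrands are uniformly close off a null set, jointly in θ
and ω. -/
theorem GridFilter.MarkovianSetting.filterConsistent (hab : a < b)
    (h : MarkovianSetting P a b X u S f W) (hX : ∀ n, Measurable (X n))
    (hXbox : ∀ n, ∀ᵐ ω ∂P, X n ω ∈ box M a b) :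
    FilterConsistent P a b X fun L _ => markovianTransition (P.map (W 0)) a b f L := by
  intro Θ g F hg hF n
  set G : Set Ω := {ω | (∀ n, X (n + 1) ω = f (X n ω) (W n ω)) ∧ (∀ n, X n ω ∈ box M a b) ∧
    ∀ n, W n ω ∈ S} with hG
  have hGae : ∀ᵐ ω ∂P, ω ∈ G := by
    filter_upwards [ae_all_iff.2 h.transition, ae_all_iff.2 hXbox, ae_all_iff.2 h.W_mem]
      with ω h1 h2 h3
    exact ⟨h1, h2, h3⟩
  set c : ℕ → ℕ → Ω → Fin M → ℝ := fun k m ω =>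
    center a b (k + 1) (quantizedChain a b (k + 1) f (X 0 ω) (fun t => W t ω) m) with hc
  choose D hD using h.l1_quantizedChain_sub_le hab
  have hcomp : ∀ {F : Θ → (Fin M → ℝ) → ℝ}, TameFamily a b F → ∀ m,
      TendstoUniformly (fun k (i : Θ × G) => F i.1 (c k m i.2)) (fun i => F i.1 (X m i.2))
        Filter.atTop := fun hF m =>
    hF.tendstoUniformly_comp (fun i : Θ × G => i.1) (p := fun k i => c k m i.2)
      (q := fun i => X m i.2) (fun k i => center_mem_box hab _ _) (fun i => i.2.2.2.1 m)
      (tendsto_const_div_add_one (D m)) fun k i => (dist_le_l1 _ _).trans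
        (hD m (k + 1) i.2 i.2.2.1 i.2.2.2.1 i.2.2.2.2)
  choose Bg hBg using fun s => (hg s).bounded
  obtain ⟨BF, hBF⟩ := hF.bounded
  have hprod : ∀ (p : ℕ → Θ × Ω → Fin M → ℝ) i, |∏ s ∈ Finset.range n, g s i.1 (p s i)|
      ≤ ∏ s ∈ Finset.range n, Bg s := fun p i => by
    rw [Finset.abs_prod]
    exact Finset.prod_le_prod (fun _ _ => abs_nonneg _) fun s _ => hBg s _ _
  have hunif := (hcomp hF n).mul_of_bounded
    (tendstoUniformly_prod_of_bounded (fun s => hcomp (hg s) (s + 1))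
      (fun s => ⟨Bg s, fun i => hBg s _ _⟩) n)
    (fun i => hBF _ _) (fun i => hprod (fun s i => X (s + 1) i.2) (i.1, i.2))
  rw [tendstoUniformly_iff_abs_le] at hunif ⊢
  intro ε hε
  obtain ⟨k₀, hk₀⟩ := hunif ε hε
  refine ⟨k₀, fun k hk θ => ?_⟩
  have hJm : ∀ m, Measurable fun ω =>
      quantizedChain a b (k + 1) f (X 0 ω) (fun t => W t ω) m := fun m =>
    measurable_quantizedChain (k + 1) h.measurable_f (hX 0) m fun i _ => h.measurable_W i
  have hcm : ∀ m, Measurable (c k m) := fun m =>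
    (measurable_of_countable (center a b (k + 1))).comp (hJm m)
  have hint : ∀ {p : ℕ → Ω → Fin M → ℝ}, (∀ s, Measurable (p s)) →
      Integrable (fun ω => ∏ s ∈ Finset.range n, g s θ (p s ω)) P := fun {p} hp =>
    Integrable.of_bound (Finset.measurable_fun_prod _ fun s _ =>
      ((hg s).continuous θ).measurable.comp (hp s)).aestronglyMeasurable _
      (ae_of_all _ fun ω => hprod (fun s i => p s i.2) (θ, ω))
  have hint' : ∀ {p : ℕ → Ω → Fin M → ℝ} {q : Ω → Fin M → ℝ}, (∀ s, Measurable (p s)) →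
      Measurable q → Integrable (fun ω => F θ (q ω) * ∏ s ∈ Finset.range n, g s θ (p s ω)) P :=
    fun {p q} hp hq => (hint hp).bdd_mul ((hF.continuous θ).measurable.comp hq).aestronglyMeasurable
      (ae_of_all _ fun ω => hBF θ (q ω))
  have hsum : ∑ l, F θ (center a b (k + 1) l) *
      weightedFilter (markovianTransition (P.map (W 0)) a b f (k + 1))
        (initialVector P a b (X 0) (k + 1)) (fun s l => g s θ (center a b (k + 1) l)) n l
      = ∫ ω, F θ (c k n ω) * ∏ s ∈ Finset.range n, g s θ (c k (s + 1) ω) ∂P := by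
    simp only [h.weightedFilter_eq hab (hX 0) (hXbox 0) (k + 1)]
    exact (integral_comp_mul_eq_sum (hJm n) (fun l => F θ (center a b (k + 1) l))
      (hint fun s => hcm (s + 1))).symm
  rw [hsum, ← integral_sub (hint' (fun s => hcm (s + 1)) (hcm n))
    (hint' (fun s => hX (s + 1)) (hX n)), ← Real.norm_eq_abs]
  have := norm_integral_le_of_norm_le_const (μ := P) (C := ε)
    (f := fun ω => F θ (c k n ω) * ∏ s ∈ Finset.range n, g s θ (c k (s + 1) ω)
      - F θ (X n ω) * ∏ s ∈ Finset.range n, g s θ (X (s + 1) ω)) (by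
      filter_upwards [hGae] with ω hω
      exact hk₀ k hk (θ, ⟨ω, hω⟩))
  simpa using this

end Markovian

/-! ### Marginal quantization -/

theorem integral_bind_kernel {α β : Type*} [MeasurableSpace α] [MeasurableSpace β]
    {μ : Measure α} {K : Kernel α β} {V : β → ℝ} (hV : Integrable V (μ.bind K)) :
    ∫ y, V y ∂(μ.bind K) = ∫ x, ∫ y, V y ∂(K x) ∂μ := by
  have h := Kernel.integral_comp (η := K) (κ := Kernel.const Unit μ) (a := ()) (f := V)
    (by rw [Kernel.comp_apply, Kernel.const_apply]; exact hV)
  rwa [Kernel.comp_apply, Kernel.const_apply] at h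

theorem abs_integral_kernel_le {α β : Type*} [MeasurableSpace α] [MeasurableSpace β]
    {K : Kernel α β} [IsMarkovKernel K] {V : β → ℝ} {B : ℝ} (hB : ∀ y, |V y| ≤ B) (x : α) :
    |∫ y, V y ∂(K x)| ≤ B := by
  have := norm_integral_le_of_norm_le_const (μ := K x) (f := V) (C := B) (ae_of_all _ hB)
  simpa using this

/-- The Markov property in integrated form. -/
theorem integral_mul_eq_integral_kernel_mul {Ω E : Type*} {m : MeasurableSpace Ω}
    [m₀ : MeasurableSpace Ω] [MeasurableSpace E] {P : Measure Ω} [IsProbabilityMeasure P] (hm : m ≤ m₀)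
    {K : Kernel E E} [IsMarkovKernel K] {X X' : Ω → E} (hX : Measurable X) (hX' : Measurable X')
    (hmarkov : ∀ A, MeasurableSet A →
      P[(X' ⁻¹' A).indicator (fun _ => (1 : ℝ)) | m] =ᵐ[P] fun ω => (K (X ω)).real A)
    {V : E → ℝ} (hV : Measurable V) {B : ℝ} (hVB : ∀ x, |V x| ≤ B)
    {H : Ω → ℝ} (hH : Measurable[m] H) {C : ℝ} (hHC : ∀ ω, |H ω| ≤ C) :
    ∫ ω, V (X' ω) * H ω ∂P = ∫ ω, (∫ y, V y ∂(K (X ω))) * H ω ∂P := by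
  have hKV : Measurable fun x => ∫ y, V y ∂(K x) := (hV.stronglyMeasurable.integral_kernel).measurable
  have hKVB := abs_integral_kernel_le (K := K) hVB
  -- The case where V is an indicator: pull H out of the conditional expectation.
  have hset : ∀ {H : Ω → ℝ}, Measurable[m] H → ∀ {C}, (∀ ω, |H ω| ≤ C) → ∀ {A}, MeasurableSet A →
      ∫ ω in X' ⁻¹' A, H ω ∂P = ∫ ω, (K (X ω)).real A * H ω ∂P := by
    intro H hH C hHC A hA
    have hHi : Integrable H P := Integrable.of_bound (hH.mono hm le_rfl).aestronglyMeasurable C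
      (ae_of_all _ hHC)
    have hI : Integrable ((X' ⁻¹' A).indicator (fun _ => (1 : ℝ))) P :=
      (integrable_const _).indicator (hX' hA)
    have hmul : (X' ⁻¹' A).indicator (fun _ => (1 : ℝ)) * H = (X' ⁻¹' A).indicator H := by
      ext ω; by_cases hω : ω ∈ X' ⁻¹' A <;> simp [hω]
    rw [← integral_indicator (hX' hA), ← hmul, ← integral_condExp hm]
    refine integral_congr_ae ?_
    filter_upwards [condExp_mul_of_stronglyMeasurable_right (m := m) hH.stronglyMeasurable
      (by rw [hmul]; exact hHi.indicator (hX' hA)) hI, hmarkov A hA] with ω h1 h2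
    rw [h1, Pi.mul_apply, h2]
  -- A nonnegative H is the density of a finite measure ν. The indicator case says that the law of
  -- X' under ν is the law of X followed by K, which extends the identity to all bounded V.
  have hpos : ∀ {H : Ω → ℝ}, Measurable[m] H → ∀ {C}, (∀ ω, |H ω| ≤ C) → (∀ ω, 0 ≤ H ω) →
      ∫ ω, V (X' ω) * H ω ∂P = ∫ ω, (∫ y, V y ∂(K (X ω))) * H ω ∂P := by
    intro H hH C hHC hH0
    have hH' : Measurable H := hH.mono hm le_rfl
    have hHi : Integrable H P := Integrable.of_bound hH'.aestronglyMeasurable C (ae_of_all _ hHC)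
    set ν : Measure Ω := P.withDensity fun ω => ENNReal.ofReal (H ω) with hν
    have hνfin : IsFiniteMeasure ν := isFiniteMeasure_withDensity_ofReal hHi.2
    have hνint : ∀ F : Ω → ℝ, ∫ ω, F ω ∂ν = ∫ ω, F ω * H ω ∂P := fun F => by
      rw [hν, integral_withDensity_eq_integral_toReal_smul hH'.ennreal_ofReal
        (ae_of_all _ fun _ => ENNReal.ofReal_lt_top)]
      refine integral_congr_ae (ae_of_all _ fun ω => ?_)
      simp only [ENNReal.toReal_ofReal (hH0 ω), smul_eq_mul, mul_comm]
    have hνX : IsFiniteMeasure (ν.map X) := Measure.isFiniteMeasure_map ν X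
    have hνX' : IsFiniteMeasure (ν.map X') := Measure.isFiniteMeasure_map ν X'
    have hbind : ν.map X' = (ν.map X).bind K := by
      ext A hA
      rw [Measure.bind_apply hA K.aemeasurable, lintegral_map (K.measurable_coe hA) hX,
        Measure.map_apply hX' hA, hν, withDensity_apply _ (hX' hA),
        lintegral_withDensity_eq_lintegral_mul _ hH'.ennreal_ofReal
          (g := fun ω => K (X ω) A) ((K.measurable_coe hA).comp hX)]
      have h1 := hset hH hHC hA
      have hKm : Measurable fun ω => (K (X ω)).real A := (K.measurable_coe hA).ennreal_toReal.comp hX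
      have hKi : Integrable (fun ω => (K (X ω)).real A * H ω) P :=
        hHi.bdd_mul (c := 1) hKm.aestronglyMeasurable (ae_of_all _ fun ω => by
          rw [Real.norm_of_nonneg measureReal_nonneg]; exact measureReal_le_one)
      rw [← ofReal_integral_eq_lintegral_ofReal hHi.integrableOn (ae_of_all _ hH0), h1,
        ofReal_integral_eq_lintegral_ofReal hKi
          (ae_of_all _ fun ω => mul_nonneg measureReal_nonneg (hH0 ω))]
      refine lintegral_congr fun ω => ?_
      rw [ENNReal.ofReal_mul measureReal_nonneg, ofReal_measureReal, mul_comm]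
      rfl
    have hVi : Integrable V (ν.map X') :=
      Integrable.of_bound hV.aestronglyMeasurable B (ae_of_all _ hVB)
    rw [← hνint fun ω => V (X' ω), ← hνint fun ω => ∫ y, V y ∂(K (X ω)),
      ← integral_map hX'.aemeasurable hV.aestronglyMeasurable, hbind,
      integral_bind_kernel (by rw [← hbind]; exact hVi),
      integral_map hX.aemeasurable hKV.aestronglyMeasurable]
  -- A signed H is shifted by the constant C to a nonnegative one, and the identity for the constant
  -- is subtracted.
  have h1 := hpos (H := fun ω => H ω + C) (hH.add_const C) (C := C + C)
    (fun ω => (abs_add_le _ _).trans (add_le_add (hHC ω) (le_of_eq (abs_of_nonneg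
      ((abs_nonneg _).trans (hHC ω)))))) fun ω => by linarith [neg_le_of_abs_le (hHC ω)]
  -- The absolute value is needed here because C ≥ 0 follows from the bound on H only if Ω has a
  -- point.
  have h2 := hpos (H := fun _ : Ω => |C|) measurable_const (C := |C|) (fun ω => (abs_abs C).le)
    fun ω => abs_nonneg C
  rcases isEmpty_or_nonempty Ω with hΩ | ⟨⟨ω₀⟩⟩
  · simp only [integral_of_isEmpty]
  have hC0 : 0 ≤ C := (abs_nonneg _).trans (hHC ω₀)
  rw [abs_of_nonneg hC0] at h2
  have hHi : Integrable H P := Integrable.of_bound (hH.mono hm le_rfl).aestronglyMeasurable C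
    (ae_of_all _ hHC)
  have i1 : Integrable (fun ω => V (X' ω)) P :=
    Integrable.of_bound (hV.comp hX').aestronglyMeasurable B (ae_of_all _ fun ω => hVB _)
  have i2 : Integrable (fun ω => ∫ y, V y ∂(K (X ω))) P :=
    Integrable.of_bound (hKV.comp hX).aestronglyMeasurable B (ae_of_all _ fun ω => hKVB _)
  have i3 : Integrable (fun ω => V (X' ω) * H ω) P :=
    hHi.bdd_mul (hV.comp hX').aestronglyMeasurable (ae_of_all _ fun ω => hVB _)
  have i4 : Integrable (fun ω => (∫ y, V y ∂(K (X ω))) * H ω) P :=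
    hHi.bdd_mul (hKV.comp hX).aestronglyMeasurable (ae_of_all _ fun ω => hKVB _)
  simp only [mul_add] at h1
  rw [integral_add i3 (i1.mul_const C), integral_add i4 (i2.mul_const C), h2] at h1
  exact add_right_cancel h1

/-! ### Cell averages of the transition kernel -/

section Marginal

variable {M : ℕ} {a b : ℝ}

theorem sum_measureReal_cell (L : ℕ) [NeZero L] (ν : Measure (Fin M → ℝ)) [IsLocallyFiniteMeasure ν] :
    ∑ l, ν.real (cell a b L l) = ν.real (box M a b) := by
  have hfin : IsFiniteMeasure (ν.restrict (box M a b)) :=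
    isFiniteMeasure_restrict.2 isCompact_Icc.measure_lt_top.ne
  have h := sum_measureReal_preimage_singleton (μ := ν.restrict (box M a b)) Finset.univ
    (f := cellIndex a b L) (fun l _ => measurable_cellIndex L (measurableSet_singleton l))
  rw [Finset.coe_univ, Set.preimage_univ, measureReal_restrict_apply MeasurableSet.univ,
    Set.univ_inter] at h
  rw [← h]
  refine Finset.sum_congr rfl fun l _ => ?_
  rw [measureReal_restrict_apply (measurable_cellIndex L (measurableSet_singleton l)), Set.inter_comm]
  rfl

/-- By Fubini the average of K(A | ·) is the integral over A of the averaged density; the pointwise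
bound on densities is then integrated over A. -/
theorem abs_sub_cellAverage_le_of_density {π : Measure (Fin M → ℝ)} [IsProbabilityMeasure π]
    {K : Kernel (Fin M → ℝ) (Fin M → ℝ)} [IsMarkovKernel K]
    {κ : (Fin M → ℝ) → (Fin M → ℝ) → ℝ} (hκm : Measurable (Function.uncurry κ))
    (hκ0 : ∀ x y, 0 ≤ κ x y)
    (hK : ∀ᵐ x ∂π, K x = volume.withDensity fun y => ENNReal.ofReal (κ x y))
    (L : ℕ) [NeZero L] {x : Fin M → ℝ}
    (hKx : K x = volume.withDensity fun y => ENNReal.ofReal (κ x y)) {d : ℝ}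
    (hd : ∀ᵐ y, |κ x y - cellAverage π a b L (fun θ => κ θ y) x| ≤ d) (l : Grid M L) :
    |(K x).real (cell a b L l) - cellAverage π a b L (fun θ => (K θ).real (cell a b L l)) x|
      ≤ d * volume.real (cell a b L l) := by
  set A := cell a b L l with hA
  have hAm : MeasurableSet A := measurableSet_cell L l
  have hAfin : volume A < ∞ :=
    (measure_mono fun y hy => hy.1).trans_lt (isCompact_Icc (a := fun _ : Fin M => a)
      (b := fun _ => b)).measure_lt_top
  set c := cell a b L (cellIndex a b L x) with hc
  have hκx : ∀ θ, Measurable (κ θ) := fun θ => hκm.comp measurable_prodMk_left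
  have hreal : ∀ θ, K θ = volume.withDensity (fun y => ENNReal.ofReal (κ θ y)) →
      IntegrableOn (κ θ) A ∧ (K θ).real A = ∫ y in A, κ θ y := by
    intro θ hθ
    have h1 : ∫⁻ y in A, ENNReal.ofReal (κ θ y) = K θ A := by rw [hθ, withDensity_apply _ hAm]
    have hi : IntegrableOn (κ θ) A := by
      refine ⟨(hκx θ).aestronglyMeasurable, ?_⟩
      rw [hasFiniteIntegral_iff_ofReal (ae_of_all _ (hκ0 θ)), h1]
      exact measure_lt_top _ _
    refine ⟨hi, ?_⟩
    rw [integral_eq_lintegral_of_nonneg_ae (ae_of_all _ (hκ0 θ)) (hκx θ).aestronglyMeasurable, h1]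
    rfl
  -- Almost every density has total mass 1, so its integral over A is at most 1.
  have hprod : Integrable (Function.uncurry κ) ((π.restrict c).prod (volume.restrict A)) := by
    refine ⟨hκm.aestronglyMeasurable, ?_⟩
    have h0 : 0 ≤ᵐ[(π.restrict c).prod (volume.restrict A)] Function.uncurry κ :=
      ae_of_all _ fun p => hκ0 p.1 p.2
    rw [hasFiniteIntegral_iff_ofReal h0, lintegral_prod _ hκm.ennreal_ofReal.aemeasurable]
    calc ∫⁻ θ in c, (∫⁻ y in A, ENNReal.ofReal (κ θ y)) ∂π
        ≤ ∫⁻ θ in c, 1 ∂π := by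
          refine lintegral_mono_ae ?_
          filter_upwards [ae_restrict_of_ae hK] with θ hθ
          rw [← withDensity_apply _ hAm, ← hθ]
          exact prob_le_one
      _ < ∞ := by simp
  have havg : cellAverage π a b L (fun θ => (K θ).real A) x
      = ∫ y in A, cellAverage π a b L (fun θ => κ θ y) x := by
    unfold cellAverage
    rw [integral_div]
    congr 1
    rw [← integral_integral_swap hprod]
    refine integral_congr_ae ?_
    filter_upwards [ae_restrict_of_ae hK] with θ hθ
    exact (hreal θ hθ).2
  have havgi : IntegrableOn (fun y => cellAverage π a b L (fun θ => κ θ y) x) A := by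
    unfold cellAverage
    exact hprod.integral_prod_right.div_const _
  obtain ⟨hi, hx⟩ := hreal x hKx
  rw [hx, havg, ← integral_sub hi havgi]
  exact norm_setIntegral_le_of_norm_le_const_ae (f := fun y => κ x y
    - cellAverage π a b L (fun θ => κ θ y) x) hAfin (ae_restrict_of_ae hd)

/-- Vitali's convergence theorem with limit 0. -/
theorem tendsto_integral_of_uniformIntegrable {α : Type*} [MeasurableSpace α] {π : Measure α}
    [IsFiniteMeasure π] {δ : ℕ → α → ℝ} (hui : UniformIntegrable δ 1 π)
    (h0 : ∀ n x, 0 ≤ δ n x) (hlim : ∀ᵐ x ∂π, Filter.Tendsto (fun n => δ n x) Filter.atTop (nhds 0)) :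
    (∀ n, Integrable (δ n) π) ∧ Filter.Tendsto (fun n => ∫ x, δ n x ∂π) Filter.atTop (nhds 0) := by
  have hint : ∀ n, Integrable (δ n) π := fun n => memLp_one_iff_integrable.1 (hui.memLp n)
  refine ⟨hint, ?_⟩
  have h := tendsto_Lp_finite_of_tendsto_ae le_rfl ENNReal.one_ne_top hui.1
    (g := fun _ => (0 : ℝ)) (MemLp.zero') hui.2.1 hlim
  have h2 := (ENNReal.tendsto_toReal ENNReal.zero_ne_top).comp h
  rw [ENNReal.toReal_zero] at h2
  refine h2.congr fun n => ?_
  have : (δ n - fun _ => (0 : ℝ)) = δ n := by ext; simp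
  rw [Function.comp_apply, this, eLpNorm_one_eq_lintegral_enorm,
    ← integral_norm_eq_lintegral_enorm (hui.1 n)]
  exact integral_congr_ae (ae_of_all _ fun x => Real.norm_of_nonneg (h0 n x))

/-- The common consequence of both types of regularity, and the only one used later. In type I there
are L^M cells, each with error δ / L^M; in type II the errors are δ times the volumes of the cells,
which add up to the volume of the cube. -/
theorem exists_kernel_bound {π : Measure (Fin M → ℝ)} [IsProbabilityMeasure π]
    {K : Kernel (Fin M → ℝ) (Fin M → ℝ)} [IsMarkovKernel K]
    (h : CRTI π a b K ∨ CRTII π a b K) :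
    ∃ e : ℕ → (Fin M → ℝ) → ℝ, (∀ k, Integrable (e k) π) ∧
      Filter.Tendsto (fun k => ∫ x, e k x ∂π) Filter.atTop (nhds 0) ∧
      ∀ᵐ x ∂π, ∀ k, ∑ l : Grid M (k + 1), |(K x).real (cell a b (k + 1) l)
        - cellAverage π a b (k + 1) (fun θ => (K θ).real (cell a b (k + 1) l)) x| ≤ e k x := by
  -- For M = 0 the number L^M stays 1 and the limit of δ gives nothing, but the state space is a
  -- single point and the kernel equals its average.
  rcases Nat.eq_zero_or_pos M with rfl | hM
  · refine ⟨fun _ _ => 0, fun k => integrable_const _, by simp, ae_of_all _ fun x k => ?_⟩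
    refine (Finset.sum_eq_zero fun l _ => ?_).le
    have hcell : cell a b (k + 1) (cellIndex a b (k + 1) x) = Set.univ := by
      ext y
      rw [Subsingleton.elim y x]
      exact iff_of_true ⟨⟨fun i => i.elim0, fun i => i.elim0⟩, rfl⟩ trivial
    unfold cellAverage
    rw [hcell, probReal_univ, div_one, Measure.restrict_univ]
    have : ∀ θ, (K θ).real (cell a b (k + 1) l) = (K x).real (cell a b (k + 1) l) := fun θ => by
      rw [Subsingleton.elim θ x]
    simp only [this, integral_const, probReal_univ, one_smul, sub_self, abs_zero]
  · have hpow : Filter.Tendsto (fun k : ℕ => (k + 1) ^ M) Filter.atTop Filter.atTop :=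
      (Filter.tendsto_pow_atTop hM.ne').comp (Filter.tendsto_add_atTop_nat 1)
    have hmain : ∀ (δ : ℕ → (Fin M → ℝ) → ℝ) (c : ℝ), (∀ n x, 0 ≤ δ n x) →
        UniformIntegrable δ 1 π →
        (∀ᵐ x ∂π, Filter.Tendsto (fun n => δ n x) Filter.atTop (nhds 0)) →
        (∀ k, Integrable (fun x => δ ((k + 1) ^ M) x * c) π) ∧ Filter.Tendsto
          (fun k => ∫ x, δ ((k + 1) ^ M) x * c ∂π) Filter.atTop (nhds 0) := by
      intro δ c h0 hui hlim
      obtain ⟨h1, h2⟩ := tendsto_integral_of_uniformIntegrable hui h0 hlim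
      refine ⟨fun k => (h1 _).mul_const _, ?_⟩
      simp only [integral_mul_const]
      simpa using (h2.comp hpow).mul_const c
    rcases h with ⟨δ, h0, hui, hlim, hb⟩ | ⟨κ, hκm, hκ0, hK, δ, h0, hui, hlim, hb⟩
    · obtain ⟨h1, h2⟩ := hmain δ 1 h0 hui hlim
      refine ⟨_, h1, h2, ?_⟩
      filter_upwards [hb] with x hx k
      refine (Finset.sum_le_sum fun l _ => hx (k + 1) l).trans (le_of_eq ?_)
      have : (((k + 1) ^ M : ℕ) : ℝ) ≠ 0 := by positivity
      simp only [Finset.sum_const, Finset.card_univ, Fintype.card_pi, Fintype.card_fin,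
        Finset.prod_const, nsmul_eq_mul]
      field_simp
    · obtain ⟨h1, h2⟩ := hmain δ (volume.real (box M a b)) h0 hui hlim
      refine ⟨_, h1, h2, ?_⟩
      filter_upwards [hb, hK] with x hx hKx k
      rw [← sum_measureReal_cell (k + 1) volume, Finset.mul_sum]
      exact Finset.sum_le_sum fun l _ =>
        abs_sub_cellAverage_le_of_density hκm hκ0 hK (k + 1) hKx (hx (k + 1)) l

end Marginal

/-! ### Convergence of the filter under marginal quantization -/

section Marginal

variable {M : ℕ} {a b : ℝ}
variable {Ω E : Type*} [MeasurableSpace Ω] [MeasurableSpace E] {P : Measure Ω}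
  [IsProbabilityMeasure P] {X : ℕ → Ω → Fin M → ℝ} {u : ℕ → Ω → E}
  {K : Kernel (Fin M → ℝ) (Fin M → ℝ)}

theorem past_le {E : Type*} [MeasurableSpace E] {Z : ℕ → Ω → E} (hZ : ∀ n, Measurable (Z n)) (n : ℕ) :
    past Z n ≤ ‹MeasurableSpace Ω› :=
  iSup₂_le fun i _ => (hZ i).comap_le

omit [MeasurableSpace Ω] in
theorem measurable_past {E : Type*} [MeasurableSpace E] (Z : ℕ → Ω → E) {i n : ℕ} (hi : i ≤ n) :
    Measurable[past Z n] (Z i) :=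
  Measurable.mono (comap_measurable (Z i)) (le_iSup₂_of_le i hi le_rfl) le_rfl

omit [IsProbabilityMeasure P] in
theorem marginalTransition_nonneg (L : ℕ) [NeZero L] (i j : Grid M L) :
    0 ≤ marginalTransition P a b X L i j := measureReal_nonneg

-- Equality can fail: a column whose conditioning event is null is zero.
omit [IsProbabilityMeasure P] in
theorem sum_marginalTransition_le_one (hX : Measurable (X 1)) (L : ℕ) [NeZero L] (j : Grid M L) :
    ∑ i, marginalTransition P a b X L i j ≤ 1 := by
  unfold marginalTransition
  simp only [Matrix.of_apply]
  set ν := cond P (X 0 ⁻¹' cell a b L j) with hν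
  calc ∑ i, ν.real (X 1 ⁻¹' cell a b L i)
      ≤ ∑ i, ν.real ((fun ω => cellIndex a b L (X 1 ω)) ⁻¹' {i}) :=
        Finset.sum_le_sum fun i _ => measureReal_mono fun ω hω => hω.2
    _ = ν.real Set.univ := by
        have h := sum_measureReal_preimage_singleton (μ := ν) Finset.univ
          (f := fun ω => cellIndex a b L (X 1 ω)) fun i _ =>
            ((measurable_cellIndex L).comp hX) (measurableSet_singleton i)
        rw [h]
        simp
    _ ≤ 1 := measureReal_le_one

theorem GridFilter.MarginalSetting.integral_mul (h : MarginalSetting P a b X u K)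
    (hX : ∀ n, Measurable (X n)) (n : ℕ) {V : (Fin M → ℝ) → ℝ} (hV : Measurable V) {B : ℝ}
    (hVB : ∀ x, |V x| ≤ B) {H : Ω → ℝ} (hH : Measurable[past X n] H) {C : ℝ}
    (hHC : ∀ ω, |H ω| ≤ C) :
    ∫ ω, V (X (n + 1) ω) * H ω ∂P = ∫ ω, (∫ y, V y ∂(K (X n ω))) * H ω ∂P :=
  haveI := h.isMarkovKernel
  integral_mul_eq_integral_kernel_mul (past_le hX n) (hX n) (hX (n + 1)) (h.markov n) hV hVB hH hHC

/-- The Markov property, tested on indicators of two cells, turns the joint probability of the first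
transition into the integral of K(𝒵^i | ·) over the cell of x. On a null cell both sides are 0. -/
theorem GridFilter.MarginalSetting.marginalTransition_eq (h : MarginalSetting P a b X u K)
    (hX : ∀ n, Measurable (X n)) (L : ℕ) [NeZero L] (i : Grid M L) (x : Fin M → ℝ) :
    marginalTransition P a b X L i (cellIndex a b L x)
      = cellAverage (P.map (X 0)) a b L (fun θ => (K θ).real (cell a b L i)) x := by
  have := h.isMarkovKernel
  set c := cell a b L (cellIndex a b L x) with hc
  have hcm : MeasurableSet c := measurableSet_cell L _
  set A := cell a b L i with hA
  have hAm : MeasurableSet A := measurableSet_cell L _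
  have hKm : Measurable fun θ => (K θ).real A := (K.measurable_coe hAm).ennreal_toReal
  have hind : ∀ (s : Set (Fin M → ℝ)) y, |s.indicator (fun _ => (1 : ℝ)) y| ≤ 1 := fun s y => by
    by_cases hy : y ∈ s <;> simp [hy]
  have hH : Measurable[past X 0] fun ω => c.indicator (fun _ => (1 : ℝ)) (X 0 ω) :=
    (measurable_const.indicator hcm).comp (measurable_past X le_rfl)
  have key := h.integral_mul hX 0 (V := A.indicator fun _ => (1 : ℝ))
    (measurable_const.indicator hAm) (hind A) hH fun ω => hind c _
  have e1 : ∫ ω, A.indicator (fun _ => (1 : ℝ)) (X (0 + 1) ω) * c.indicator (fun _ => (1 : ℝ)) (X 0 ω) ∂P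
      = P.real (X 0 ⁻¹' c ∩ X 1 ⁻¹' A) := by
    rw [← integral_indicator_one ((hX 0 hcm).inter (hX 1 hAm))]
    refine integral_congr_ae (ae_of_all _ fun ω => ?_)
    by_cases h0 : X 0 ω ∈ c <;> by_cases h1 : X 1 ω ∈ A <;> simp [h0, h1]
  have e2 : ∫ ω, (∫ y, A.indicator (fun _ => (1 : ℝ)) y ∂(K (X 0 ω)))
      * c.indicator (fun _ => (1 : ℝ)) (X 0 ω) ∂P = ∫ θ in c, (K θ).real A ∂(P.map (X 0)) := by
    rw [setIntegral_map hcm hKm.aestronglyMeasurable (hX 0).aemeasurable,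
      ← integral_indicator (hX 0 hcm)]
    refine integral_congr_ae (ae_of_all _ fun ω => ?_)
    have : ∫ y, A.indicator (fun _ => (1 : ℝ)) y ∂(K (X 0 ω)) = (K (X 0 ω)).real A :=
      integral_indicator_one hAm
    simp only [this]
    by_cases h0 : X 0 ω ∈ c <;> simp [h0]
  rw [e1, e2] at key
  unfold marginalTransition cellAverage
  rw [Matrix.of_apply, ← hc, ← key, map_measureReal_apply (hX 0) hcm, measureReal_def,
    cond_apply (hX 0 hcm), ENNReal.toReal_mul, ENNReal.toReal_inv, div_eq_inv_mul]
  rfl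

/-- A bounded sequence of families of functions of the labels that converges in `L¹(π)`, uniformly
over the family. -/
structure LabelL1Limit {Θ : Type*} (π : Measure (Fin M → ℝ)) (a b : ℝ)
    (Vk : ∀ k, Θ → Grid M (k + 1) → ℝ) (V : Θ → (Fin M → ℝ) → ℝ) : Prop where
  measurable : ∀ θ, Measurable (V θ)
  bounded : ∃ B, (∀ θ x, |V θ x| ≤ B) ∧ ∀ k θ l, |Vk k θ l| ≤ B
  tendsto : ∀ ε : ℝ, 0 < ε → ∃ k₀, ∀ k, k₀ ≤ k → ∀ θ,
    ∫ x, |Vk k θ (cellIndex a b (k + 1) x) - V θ x| ∂π ≤ ε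

theorem LabelL1Limit.measurable_abs_sub {Θ : Type*} {π : Measure (Fin M → ℝ)}
    {Vk : ∀ k, Θ → Grid M (k + 1) → ℝ} {V : Θ → (Fin M → ℝ) → ℝ} (hV : LabelL1Limit π a b Vk V)
    (k : ℕ) (θ : Θ) :
    Measurable fun x => |Vk k θ (cellIndex a b (k + 1) x) - V θ x| := by
  have h1 : Measurable fun x => Vk k θ (cellIndex a b (k + 1) x) :=
    (measurable_of_countable (Vk k θ)).comp (measurable_cellIndex (k + 1))
  exact (h1.sub (hV.measurable θ)).abs

theorem LabelL1Limit.of_tameFamily {Θ : Type*} {π : Measure (Fin M → ℝ)} [IsProbabilityMeasure π]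
    (hab : a < b) (hπ : ∀ᵐ x ∂π, x ∈ box M a b) {F : Θ → (Fin M → ℝ) → ℝ} (hF : TameFamily a b F) :
    LabelL1Limit π a b (fun k θ l => F θ (center a b (k + 1) l)) F where
  measurable θ := (hF.continuous θ).measurable
  bounded := by
    obtain ⟨B, hB⟩ := hF.bounded
    exact ⟨B, hB, fun _ _ _ => hB _ _⟩
  tendsto ε hε := by
    have h := hF.tendstoUniformly_comp (fun i : Θ × box M a b => i.1)
      (p := fun k i => center a b (k + 1) (cellIndex a b (k + 1) i.2.1)) (q := fun i => i.2.1)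
      (fun k i => center_mem_box hab _ _) (fun i => i.2.2) (tendsto_const_div_add_one (b - a))
      fun k i => dist_center_cellIndex_le hab (k + 1) i.2.2
    rw [tendstoUniformly_iff_abs_le] at h
    obtain ⟨k₀, hk₀⟩ := h ε hε
    refine ⟨k₀, fun k hk θ => ?_⟩
    refine (le_abs_self _).trans ?_
    have := norm_integral_le_of_norm_le_const (μ := π) (C := ε)
      (f := fun x => |F θ (center a b (k + 1) (cellIndex a b (k + 1) x)) - F θ x|) (by
        filter_upwards [hπ] with x hx
        rw [Real.norm_eq_abs, abs_abs]
        exact hk₀ k hk (θ, ⟨x, hx⟩))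
    simpa using this

theorem LabelL1Limit.mul {Θ : Type*} {π : Measure (Fin M → ℝ)} [IsProbabilityMeasure π]
    {Uk Vk : ∀ k, Θ → Grid M (k + 1) → ℝ} {U V : Θ → (Fin M → ℝ) → ℝ}
    (hU : LabelL1Limit π a b Uk U) (hV : LabelL1Limit π a b Vk V) :
    LabelL1Limit π a b (fun k θ l => Uk k θ l * Vk k θ l) (fun θ x => U θ x * V θ x) where
  measurable θ := (hU.measurable θ).mul (hV.measurable θ)
  bounded := by
    obtain ⟨B, h1, h2⟩ := hU.bounded
    obtain ⟨C, h3, h4⟩ := hV.bounded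
    refine ⟨B * C, fun θ x => ?_, fun k θ l => ?_⟩
    · rw [abs_mul]
      exact mul_le_mul (h1 θ x) (h3 θ x) (abs_nonneg _) ((abs_nonneg _).trans (h1 θ x))
    · rw [abs_mul]
      exact mul_le_mul (h2 k θ l) (h4 k θ l) (abs_nonneg _) ((abs_nonneg _).trans (h2 k θ l))
  tendsto ε hε := by
    obtain ⟨B, h1, h2⟩ := hU.bounded
    obtain ⟨C, h3, h4⟩ := hV.bounded
    set D := |B| + |C| + 1 with hD
    have hD0 : 0 < D := by positivity
    obtain ⟨k₁, hk₁⟩ := hU.tendsto (ε / (2 * D)) (by positivity)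
    obtain ⟨k₂, hk₂⟩ := hV.tendsto (ε / (2 * D)) (by positivity)
    refine ⟨max k₁ k₂, fun k hk θ => ?_⟩
    have hUi : Integrable (fun x => |Uk k θ (cellIndex a b (k + 1) x) - U θ x|) π :=
      Integrable.of_bound (hU.measurable_abs_sub k θ).aestronglyMeasurable (B + B)
        (ae_of_all _ fun x => by
          rw [Real.norm_eq_abs, abs_abs]
          exact (abs_sub _ _).trans (add_le_add (h2 _ _ _) (h1 _ _)))
    have hVi : Integrable (fun x => |Vk k θ (cellIndex a b (k + 1) x) - V θ x|) π :=
      Integrable.of_bound (hV.measurable_abs_sub k θ).aestronglyMeasurable (C + C)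
        (ae_of_all _ fun x => by
          rw [Real.norm_eq_abs, abs_abs]
          exact (abs_sub _ _).trans (add_le_add (h4 _ _ _) (h3 _ _)))
    calc ∫ x, |Uk k θ (cellIndex a b (k + 1) x) * Vk k θ (cellIndex a b (k + 1) x)
          - U θ x * V θ x| ∂π
        ≤ ∫ x, (D * |Uk k θ (cellIndex a b (k + 1) x) - U θ x|
          + D * |Vk k θ (cellIndex a b (k + 1) x) - V θ x|) ∂π := by
          refine integral_mono_of_nonneg (ae_of_all _ fun x => abs_nonneg _)
            ((hUi.const_mul D).add (hVi.const_mul D)) (ae_of_all _ fun x => ?_)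
          set p := Uk k θ (cellIndex a b (k + 1) x)
          set q := Vk k θ (cellIndex a b (k + 1) x)
          have hq : |q| ≤ D := by
            linarith [h4 k θ (cellIndex a b (k + 1) x), le_abs_self C, abs_nonneg B]
          have hu : |U θ x| ≤ D := by linarith [h1 θ x, le_abs_self B, abs_nonneg C]
          calc |p * q - U θ x * V θ x| = |(p - U θ x) * q + U θ x * (q - V θ x)| := by ring_nf
            _ ≤ |p - U θ x| * |q| + |U θ x| * |q - V θ x| := by
                rw [← abs_mul, ← abs_mul]; exact abs_add_le _ _
            _ ≤ |p - U θ x| * D + D * |q - V θ x| := by gcongr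
            _ = _ := by ring
      _ = D * ∫ x, |Uk k θ (cellIndex a b (k + 1) x) - U θ x| ∂π
          + D * ∫ x, |Vk k θ (cellIndex a b (k + 1) x) - V θ x| ∂π := by
          rw [integral_add (hUi.const_mul D) (hVi.const_mul D), integral_const_mul,
            integral_const_mul]
      _ ≤ D * (ε / (2 * D)) + D * (ε / (2 * D)) := by
          gcongr
          · exact hk₁ k (le_of_max_le_left hk) θ
          · exact hk₂ k (le_of_max_le_right hk) θ
      _ = ε := by field_simp; ring

/-- Two errors arise. Replacing the matrix by the kernel costs at most |B| times the bound of
`exists_kernel_bound`, since the columns are cell averages. Replacing Vk by V under the kernel costs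
∫ |Vk - V| dK, whose π-integral is the L¹(π) distance of Vk and V, because π is invariant. -/
theorem GridFilter.MarginalSetting.labelL1Limit_transition {Θ : Type*}
    (h : MarginalSetting P a b X u K) (hX : ∀ n, Measurable (X n))
    (hXbox : ∀ᵐ ω ∂P, X 0 ω ∈ box M a b) {Vk : ∀ k, Θ → Grid M (k + 1) → ℝ}
    {V : Θ → (Fin M → ℝ) → ℝ} (hV : LabelL1Limit (P.map (X 0)) a b Vk V) :
    LabelL1Limit (P.map (X 0)) a b
      (fun k θ j => ∑ i, marginalTransition P a b X (k + 1) i j * Vk k θ i)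
      (fun θ x => ∫ y, V θ y ∂(K x)) := by
  have := h.isMarkovKernel
  set π := P.map (X 0) with hπ
  have hπp : IsProbabilityMeasure π := Measure.isProbabilityMeasure_map (hX 0).aemeasurable
  obtain ⟨B, hB1, hB2⟩ := hV.bounded
  obtain ⟨e, he, helim, heb⟩ := exists_kernel_bound h.regular
  have hinv : π.bind K = π := h.stationary
  have hπbox : ∀ᵐ x ∂π, x ∈ box M a b :=
    (ae_map_iff (hX 0).aemeasurable measurableSet_box).2 hXbox
  -- By invariance K(· | x) is carried by the cube for almost all x, so no mass is lost outside the
  -- cells.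
  have hKbox : ∀ᵐ x ∂π, ∀ᵐ y ∂(K x), y ∈ box M a b :=
    Measure.ae_ae_of_ae_bind K.aemeasurable (by rw [hinv]; exact hπbox)
  have hKm : ∀ θ, Measurable fun x => ∫ y, V θ y ∂(K x) := fun θ =>
    ((hV.measurable θ).stronglyMeasurable.integral_kernel).measurable
  have hbd : ∀ k θ j, |∑ i, marginalTransition P a b X (k + 1) i j * Vk k θ i| ≤ |B| := by
    intro k θ j
    calc |∑ i, marginalTransition P a b X (k + 1) i j * Vk k θ i|
        ≤ ∑ i, |marginalTransition P a b X (k + 1) i j * Vk k θ i| :=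
          Finset.abs_sum_le_sum_abs _ _
      _ ≤ ∑ i, marginalTransition P a b X (k + 1) i j * |B| := by
          refine Finset.sum_le_sum fun i _ => ?_
          rw [abs_mul, abs_of_nonneg (marginalTransition_nonneg _ _ _)]
          exact mul_le_mul_of_nonneg_left ((hB2 _ _ _).trans (le_abs_self B))
            (marginalTransition_nonneg _ _ _)
      _ ≤ 1 * |B| := by
          rw [← Finset.sum_mul]
          exact mul_le_mul_of_nonneg_right (sum_marginalTransition_le_one (hX 1) _ _) (abs_nonneg B)
      _ = |B| := one_mul _
  refine ⟨hKm, ⟨|B|, fun θ x => (abs_integral_kernel_le (hB1 θ) x).trans (le_abs_self B), hbd⟩,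
    fun ε hε => ?_⟩
  have hB0 : 0 < |B| + 1 := by positivity
  obtain ⟨k₁, hk₁⟩ := Filter.eventually_atTop.1
    (helim.eventually_lt_const (show 0 < ε / (2 * (|B| + 1)) by positivity))
  obtain ⟨k₂, hk₂⟩ := hV.tendsto (ε / 2) (by positivity)
  refine ⟨max k₁ k₂, fun k hk θ => ?_⟩
  set D : (Fin M → ℝ) → ℝ := fun y => |Vk k θ (cellIndex a b (k + 1) y) - V θ y| with hD
  have hDm : Measurable D := hV.measurable_abs_sub k θ
  have hDB : ∀ y, |D y| ≤ B + B := fun y => by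
    rw [hD, abs_abs]
    exact (abs_sub _ _).trans (add_le_add (hB2 _ _ _) (hB1 _ _))
  have hDi : ∀ (μ : Measure (Fin M → ℝ)) [IsFiniteMeasure μ], Integrable D μ := fun μ _ =>
    Integrable.of_bound hDm.aestronglyMeasurable (B + B) (ae_of_all _ hDB)
  have hKD : Integrable (fun x => ∫ y, D y ∂(K x)) π :=
    Integrable.of_bound hDm.stronglyMeasurable.integral_kernel.aestronglyMeasurable (B + B)
      (ae_of_all _ fun x => abs_integral_kernel_le hDB x)
  have hVkm : Measurable fun y => Vk k θ (cellIndex a b (k + 1) y) :=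
    (measurable_of_countable (Vk k θ)).comp (measurable_cellIndex (k + 1))
  have hpt : ∀ᵐ x ∂π, |∑ i, marginalTransition P a b X (k + 1) i (cellIndex a b (k + 1) x)
      * Vk k θ i - ∫ y, V θ y ∂(K x)| ≤ |B| * e k x + ∫ y, D y ∂(K x) := by
    filter_upwards [heb, hKbox] with x hx hxbox
    have e1 : ∫ y, Vk k θ (cellIndex a b (k + 1) y) ∂(K x)
        = ∑ i, (K x).real (cell a b (k + 1) i) * Vk k θ i := by
      have h1 := integral_comp_mul_eq_sum (P := K x) (measurable_cellIndex (a := a) (b := b) (k + 1))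
        (Vk k θ) (integrable_const (1 : ℝ))
      simp only [mul_one] at h1
      rw [h1]
      refine Finset.sum_congr rfl fun i _ => ?_
      rw [integral_const, smul_eq_mul, mul_one, measureReal_restrict_apply MeasurableSet.univ,
        Set.univ_inter, mul_comm]
      congr 1
      refine measureReal_congr ?_
      filter_upwards [hxbox] with y hy
      exact propext ⟨fun hc => ⟨hy, hc⟩, fun hc => hc.2⟩
    have e2 : |∑ i, marginalTransition P a b X (k + 1) i (cellIndex a b (k + 1) x) * Vk k θ i
        - ∫ y, Vk k θ (cellIndex a b (k + 1) y) ∂(K x)| ≤ |B| * e k x := by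
      rw [e1, ← Finset.sum_sub_distrib]
      refine (Finset.abs_sum_le_sum_abs _ _).trans
        (le_trans ?_ (mul_le_mul_of_nonneg_left (hx k) (abs_nonneg B)))
      rw [Finset.mul_sum]
      refine Finset.sum_le_sum fun i _ => ?_
      rw [← sub_mul, abs_mul, h.marginalTransition_eq hX, mul_comm, abs_sub_comm]
      exact mul_le_mul_of_nonneg_right ((hB2 _ _ _).trans (le_abs_self B)) (abs_nonneg _)
    have i1 : Integrable (fun y => Vk k θ (cellIndex a b (k + 1) y)) (K x) :=
      Integrable.of_bound hVkm.aestronglyMeasurable B (ae_of_all _ fun y => hB2 _ _ _)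
    have i2 : Integrable (V θ) (K x) :=
      Integrable.of_bound (hV.measurable θ).aestronglyMeasurable B (ae_of_all _ fun y => hB1 _ _)
    have e3 : |∫ y, Vk k θ (cellIndex a b (k + 1) y) ∂(K x) - ∫ y, V θ y ∂(K x)|
        ≤ ∫ y, D y ∂(K x) := by
      rw [← integral_sub i1 i2]
      exact abs_integral_le_integral_abs
    exact (abs_sub_le _ _ _).trans (add_le_add e2 e3)
  calc ∫ x, |∑ i, marginalTransition P a b X (k + 1) i (cellIndex a b (k + 1) x) * Vk k θ i
        - ∫ y, V θ y ∂(K x)| ∂π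
      ≤ ∫ x, (|B| * e k x + ∫ y, D y ∂(K x)) ∂π :=
        integral_mono_of_nonneg (ae_of_all _ fun x => abs_nonneg _) (((he k).const_mul _).add hKD) hpt
    _ = |B| * ∫ x, e k x ∂π + ∫ x, D x ∂π := by
        rw [integral_add ((he k).const_mul _) hKD, integral_const_mul,
          ← integral_bind_kernel (by rw [hinv]; exact hDi π), hinv]
    _ ≤ |B| * (ε / (2 * (|B| + 1))) + ε / 2 :=
        add_le_add (mul_le_mul_of_nonneg_left (hk₁ k (le_of_max_le_left hk)).le (abs_nonneg B))
          (hk₂ k (le_of_max_le_right hk) θ)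
    _ ≤ (|B| + 1) * (ε / (2 * (|B| + 1))) + ε / 2 := by
        gcongr; linarith
    _ = ε := by field_simp; ring

theorem GridFilter.MarginalSetting.filterConsistent (hab : a < b)
    (h : MarginalSetting P a b X u K) (hX : ∀ n, Measurable (X n))
    (hXbox : ∀ n, ∀ᵐ ω ∂P, X n ω ∈ box M a b) :
    FilterConsistent P a b X fun L _ => marginalTransition P a b X L := by
  intro Θ g F hg hF n
  have := h.isMarkovKernel
  have hπp : IsProbabilityMeasure (P.map (X 0)) :=
    Measure.isProbabilityMeasure_map (hX 0).aemeasurable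
  have hπbox : ∀ᵐ x ∂(P.map (X 0)), x ∈ box M a b :=
    (ae_map_iff (hX 0).aemeasurable measurableSet_box).2 (hXbox 0)
  have hgL : ∀ s, LabelL1Limit (P.map (X 0)) a b
    (fun k θ l => g s θ (center a b (k + 1) l)) (g s) := fun s => .of_tameFamily hab hπbox (hg s)
  have hFL := LabelL1Limit.of_tameFamily hab hπbox hF
  clear hF
  choose Bg hBg using fun s => (hg s).bounded
  -- Test functions are generalized before the induction: the kernel need not preserve continuity,
  -- whereas L¹(π) limits of functions of the label are stable under one step.
  suffices hmain : ∀ (Vk : ∀ k, Θ → Grid M (k + 1) → ℝ) (V : Θ → (Fin M → ℝ) → ℝ),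
      LabelL1Limit (P.map (X 0)) a b Vk V →
      TendstoUniformly (fun (k : ℕ) θ => ∑ l, Vk k θ l *
        weightedFilter (marginalTransition P a b X (k + 1)) (initialVector P a b (X 0) (k + 1))
          (fun s l => g s θ (center a b (k + 1) l)) n l)
      (fun θ => ∫ ω, V θ (X n ω) * ∏ s ∈ Finset.range n, g s θ (X (s + 1) ω) ∂P) Filter.atTop from
    hmain _ _ hFL
  clear hFL
  induction n with
  | zero =>
    intro Vk V hV
    obtain ⟨B, hB1, hB2⟩ := hV.bounded
    rw [tendstoUniformly_iff_abs_le]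
    intro ε hε
    obtain ⟨k₀, hk₀⟩ := hV.tendsto ε hε
    refine ⟨k₀, fun k hk θ => le_trans ?_ (hk₀ k hk θ)⟩
    have hJ : Measurable fun ω => cellIndex a b (k + 1) (X 0 ω) :=
      (measurable_cellIndex (k + 1)).comp (hX 0)
    have h1 := integral_comp_mul_eq_sum (P := P) hJ (Vk k θ) (integrable_const (1 : ℝ))
    have h2 : ∑ l, Vk k θ l * weightedFilter (marginalTransition P a b X (k + 1))
        (initialVector P a b (X 0) (k + 1)) (fun s l => g s θ (center a b (k + 1) l)) 0 l
        = ∫ ω, Vk k θ (cellIndex a b (k + 1) (X 0 ω)) ∂P := by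
      simp only [mul_one] at h1
      rw [h1]
      refine Finset.sum_congr rfl fun l _ => ?_
      rw [integral_const, smul_eq_mul, mul_one, measureReal_restrict_apply MeasurableSet.univ,
        Set.univ_inter]
      congr 1
      refine measureReal_congr ?_
      filter_upwards [hXbox 0] with ω hω
      exact propext ⟨fun hc => hc.2, fun hc => ⟨hω, hc⟩⟩
    have i1 : Integrable (fun ω => Vk k θ (cellIndex a b (k + 1) (X 0 ω))) P :=
      Integrable.of_bound ((measurable_of_countable (Vk k θ)).comp hJ).aestronglyMeasurable B
        (ae_of_all _ fun ω => hB2 _ _ _)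
    have i2 : Integrable (fun ω => V θ (X 0 ω)) P :=
      Integrable.of_bound ((hV.measurable θ).comp (hX 0)).aestronglyMeasurable B
        (ae_of_all _ fun ω => hB1 _ _)
    simp only [Finset.range_zero, Finset.prod_empty, mul_one]
    rw [h2, ← integral_sub i1 i2, integral_map (hX 0).aemeasurable
      (hV.measurable_abs_sub k θ).aestronglyMeasurable]
    exact abs_integral_le_integral_abs
  | succ n ih =>
    intro Vk V hV
    have hgV := (hgL n).mul hV
    -- The last filter step is moved onto the test function: multiply by the weight, then apply the
    -- transposed matrix. On the side of the limit, the same move is the Markov property.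
    have key := ih _ _ (h.labelL1Limit_transition hX (hXbox 0) hgV)
    obtain ⟨B, hB1, hB2⟩ := hgV.bounded
    convert key using 1
    · ext k θ
      simp only [weightedFilter, Matrix.mulVec, dotProduct, Finset.mul_sum, Finset.sum_mul]
      rw [Finset.sum_comm]
      exact Finset.sum_congr rfl fun j _ => Finset.sum_congr rfl fun i _ => by ring
    · ext θ
      have hH : Measurable[past X n] fun ω => ∏ s ∈ Finset.range n, g s θ (X (s + 1) ω) :=
        @Finset.measurable_fun_prod _ _ _ _ _ _ (past X n) _ _ fun s hs =>
          ((hg s).continuous θ).measurable.comp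
            (measurable_past X (Nat.succ_le_of_lt (Finset.mem_range.1 hs)))
      rw [← h.integral_mul hX n (hgV.measurable θ) (hB1 θ) hH
        (C := ∏ s ∈ Finset.range n, Bg s) fun ω => ?_]
      · refine integral_congr_ae (ae_of_all _ fun ω => ?_)
        simp only [Finset.prod_range_succ]
        ring
      · rw [Finset.abs_prod]
        exact Finset.prod_le_prod (fun _ _ => abs_nonneg _) fun s _ => hBg s _ _

end Marginal

/-! ### Extension of the observation model beyond the cube -/

section Clamp

variable {M N : ℕ} {a b : ℝ}

/-- The nearest point of the cube. -/
def clampBox (a b : ℝ) (x : Fin M → ℝ) : Fin M → ℝ := fun m => max a (min b (x m))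

theorem continuous_clampBox : Continuous (clampBox (M := M) a b) := by
  unfold clampBox; fun_prop

theorem clampBox_mem_box (hab : a < b) (x : Fin M → ℝ) : clampBox a b x ∈ box M a b :=
  ⟨fun _ => le_max_left _ _, fun _ => max_le hab.le (min_le_left _ _)⟩

theorem clampBox_of_mem_box {x : Fin M → ℝ} (hx : x ∈ box M a b) : clampBox a b x = x := by
  ext m
  rw [clampBox, min_eq_right (hx.2 m), max_eq_right (hx.1 m)]

/-- The observation model with coefficients evaluated at the nearest point of the cube. -/
def GridFilter.ObservationModel.clamp (obs : ObservationModel M N) (a b : ℝ) : ObservationModel M N where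
  mean t x := obs.mean t (clampBox a b x)
  Sig t x := obs.Sig t (clampBox a b x)
  sigma := obs.sigma

theorem GridFilter.ObservationModel.clamp_observe (obs : ObservationModel M N) (t : ℕ) {x : Fin M → ℝ}
    (hx : x ∈ box M a b) (v : EuclideanSpace ℝ (Fin N)) :
    (obs.clamp a b).observe t x v = obs.observe t x v := by
  simp only [observe, Cov, clamp, clampBox_of_mem_box hx]

theorem GridFilter.ObservationModel.clamp_likelihood (obs : ObservationModel M N) (t : ℕ)
    (x : Fin M → ℝ) (y : EuclideanSpace ℝ (Fin N)) :
    (obs.clamp a b).likelihood t x y = obs.likelihood t (clampBox a b x) y := rfl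

theorem continuous_of_abs_sub_le {q : (Fin M → ℝ) → Fin M → ℝ} (hq : Continuous q)
    {f : (Fin M → ℝ) → ℝ} {K : ℝ} (h : ∀ x x', |f x - f x'| ≤ K * l1 (q x - q x')) :
    Continuous f := by
  refine continuous_iff_continuousAt.2 fun x₀ => ?_
  have h1 : Continuous fun x => K * l1 (q x - q x₀) := by unfold l1; fun_prop
  have h2 := h1.tendsto x₀
  simp only [sub_self] at h2
  have h3 : K * l1 (0 : Fin M → ℝ) = 0 := by simp [l1]
  rw [h3] at h2
  rw [ContinuousAt, tendsto_iff_dist_tendsto_zero]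
  exact squeeze_zero (fun _ => dist_nonneg) (fun x => h x x₀) h2

/-- The assumptions concern the cube only. Composition with the nearest-point map gives coefficients
that are continuous and nondegenerate everywhere, as Bayes' formula needs. -/
theorem GridFilter.ObservationModel.Regular.isContinuous_clamp {obs : ObservationModel M N} (hab : a < b)
    (h : obs.Regular (box M a b)) : (obs.clamp a b).IsContinuous where
  mean t := by
    obtain ⟨K, hK⟩ := h.mean_lipschitz
    have h1 : Continuous fun x i => (obs.mean t (clampBox a b x)) i :=
      continuous_pi fun i => continuous_of_abs_sub_le (K := K) (continuous_clampBox (a := a) (b := b))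
        fun x x' => le_trans (Finset.single_le_sum (f := fun i =>
          |obs.mean t (clampBox a b x) i - obs.mean t (clampBox a b x') i|)
          (fun _ _ => abs_nonneg _) (Finset.mem_univ i))
          (hK t _ (clampBox_mem_box hab x) _ (clampBox_mem_box hab x'))
    exact (PiLp.continuous_toLp 2 _).comp h1
  cov t := by
    obtain ⟨K, hK⟩ := h.sig_lipschitz
    refine Continuous.add (continuous_matrix fun i j => ?_) continuous_const
    exact continuous_of_abs_sub_le (K := K) (continuous_clampBox (a := a) (b := b)) fun x x' =>
      hK t _ (clampBox_mem_box hab x) _ (clampBox_mem_box hab x') i j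
  posDef t x := by
    refine (h.sig_posDef t _ (clampBox_mem_box hab x)).add_posSemidef ?_
    exact Matrix.PosSemidef.one.smul (sq_nonneg _)

theorem isCompact_box : IsCompact (box M a b) := isCompact_Icc

theorem TameFamily.reindex {Θ Θ' : Type*} {F : Θ → (Fin M → ℝ) → ℝ} (hF : TameFamily a b F)
    (τ : Θ' → Θ) : TameFamily a b fun θ => F (τ θ) where
  continuous _ := hF.continuous _
  bounded := let ⟨B, hB⟩ := hF.bounded; ⟨B, fun _ _ => hB _ _⟩
  equicontinuous ε hε := let ⟨δ, hδ, h⟩ := hF.equicontinuous ε hε; ⟨δ, hδ, fun _ => h _⟩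

theorem TameFamily.of_continuous {Θ : Type*} {f : (Fin M → ℝ) → ℝ} (hf : Continuous f)
    (hb : ∃ B, ∀ x, |f x| ≤ B) : TameFamily a b fun _ : Θ => f where
  continuous _ := hf
  bounded := let ⟨B, hB⟩ := hb; ⟨B, fun _ => hB⟩
  equicontinuous ε hε := by
    obtain ⟨δ, hδ, h⟩ := Metric.uniformContinuousOn_iff_le.1
      (isCompact_box.uniformContinuousOn_of_continuous hf.continuousOn) ε hε
    exact ⟨δ, hδ, fun _ x hx x' hx' => h x hx x' hx'⟩

variable {obs : ObservationModel M N}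

/-- The likelihood is jointly continuous on the compact product of cube and ball; clamping extends
the bound to all x. -/
theorem tameFamily_clamp_likelihood (hab : a < b) (hobs : (obs.clamp a b).IsContinuous) (s : ℕ) (R : ℝ) :
    TameFamily a b fun (y : Metric.closedBall (0 : EuclideanSpace ℝ (Fin N)) R) x =>
      (obs.clamp a b).likelihood s x y := by
  have hcont := hobs.continuous_likelihood s
  have hcomp : IsCompact (box M a b ×ˢ Metric.closedBall (0 : EuclideanSpace ℝ (Fin N)) R) :=
    isCompact_box.prod (isCompact_closedBall _ _)
  refine ⟨fun y => ?_, ?_, fun ε hε => ?_⟩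
  · have e : Continuous fun x : Fin M → ℝ => (x, (y : EuclideanSpace ℝ (Fin N))) := by fun_prop
    have := hcont.comp e
    exact this
  · obtain ⟨B, hB⟩ := hcomp.exists_bound_of_continuousOn hcont.continuousOn
    refine ⟨B, fun y x => ?_⟩
    have := hB (clampBox a b x, y) ⟨clampBox_mem_box hab x, y.2⟩
    rwa [obs.clamp_likelihood, clampBox_of_mem_box (clampBox_mem_box hab x)] at this
  · obtain ⟨δ, hδ, h⟩ := Metric.uniformContinuousOn_iff_le.1
      (hcomp.uniformContinuousOn_of_continuous hcont.continuousOn) ε hε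
    refine ⟨δ, hδ, fun y x hx x' hx' hd => ?_⟩
    refine h (x, y) ⟨hx, y.2⟩ (x', y) ⟨hx', y.2⟩ ?_
    rw [Prod.dist_eq, dist_self]
    exact max_le hd hδ.le

/-- Compactness again, now for the reciprocal of the likelihood. This is what keeps the normalizing
constants away from 0. -/
theorem exists_le_clamp_likelihood (hab : a < b) (hobs : (obs.clamp a b).IsContinuous) (s : ℕ) (R : ℝ) :
    ∃ c : ℝ, 0 < c ∧ ∀ x, ∀ y : EuclideanSpace ℝ (Fin N), ‖y‖ ≤ R →
      c ≤ (obs.clamp a b).likelihood s x y := by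
  have hcont := (hobs.continuous_likelihood s).inv₀ fun p => (hobs.likelihood_pos s p.1 p.2).ne'
  have hcomp : IsCompact (box M a b ×ˢ Metric.closedBall (0 : EuclideanSpace ℝ (Fin N)) R) :=
    isCompact_box.prod (isCompact_closedBall _ _)
  obtain ⟨B, hB⟩ := hcomp.exists_bound_of_continuousOn hcont.continuousOn
  refine ⟨(|B| + 1)⁻¹, by positivity, fun x y hy => ?_⟩
  have h1 : ‖((obs.clamp a b).likelihood s (clampBox a b x) y)⁻¹‖ ≤ B :=
    hB (clampBox a b x, y) ⟨clampBox_mem_box hab x, mem_closedBall_zero_iff.2 hy⟩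
  have h2 := hobs.likelihood_pos s x y
  rw [obs.clamp_likelihood, clampBox_of_mem_box (clampBox_mem_box hab x),
    ← obs.clamp_likelihood, Real.norm_of_nonneg (inv_pos.2 h2).le] at h1
  exact inv_le_of_inv_le₀ h2 (h1.trans (by linarith [le_abs_self B]))

end Clamp

/-! ### Convergence of the normalized filter -/

section Normalized

universe v

variable {M N : ℕ} {a b : ℝ} {Ω : Type v} [MeasurableSpace Ω] {P : Measure Ω}
  [IsProbabilityMeasure P] {X : ℕ → Ω → Fin M → ℝ} {obs : ObservationModel M N}
  {Pm : ∀ (L : ℕ) [NeZero L], Matrix (Grid M L) (Grid M L) ℝ}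

theorem tendstoUniformly_predictive (hab : a < b) (hobs : (obs.clamp a b).IsContinuous)
    (hX : ∀ n, Measurable (X n)) (hcons : FilterConsistent P a b X Pm)
    (hPm : ∀ (L : ℕ) [NeZero L] (i j : Grid M L), 0 ≤ Pm L i j)
    {Θ : Type v} (y : ℕ → Θ → EuclideanSpace ℝ (Fin N)) {R : ℝ} {t : ℕ}
    (hy : ∀ s ≤ t, ∀ θ, ‖y s θ‖ ≤ R) {h : (Fin M → ℝ) → ℝ} (hh : Continuous h)
    (hb : ∃ B, ∀ x, |h x| ≤ B) (ρ : ℕ) :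
    TendstoUniformly (fun (k : ℕ) θ => ∑ l, h (center a b (k + 1) l) *
        predictive (Pm (k + 1)) ρ (unnormalizedFilter obs a b (k + 1) (Pm (k + 1))
          (initialVector P a b (X 0) (k + 1)) (fun s => y s θ) (t + 1)) l)
      (fun θ => (∫ ω, h (X (t + ρ + 1) ω) *
          ∏ s ∈ Finset.range (t + 1), (obs.clamp a b).likelihood s (X (s + 1) ω) (y s θ) ∂P)
        / ∫ ω, ∏ s ∈ Finset.range (t + 1),
          (obs.clamp a b).likelihood s (X (s + 1) ω) (y s θ) ∂P) Filter.atTop := by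
  set lik := (obs.clamp a b).likelihood with hlik
  -- Weight 1 after time t encodes the ρ prediction steps.
  set g : ℕ → Θ → (Fin M → ℝ) → ℝ := fun s θ x => if s < t + 1 then lik s x (y s θ) else 1 with hg
  have hgt : ∀ s, TameFamily a b (g s) := by
    intro s
    by_cases hs : s < t + 1
    · simp only [hg, if_pos hs]
      exact (tameFamily_clamp_likelihood hab hobs s R).reindex fun θ =>
        ⟨y s θ, mem_closedBall_zero_iff.2 (hy s (Nat.le_of_lt_succ hs) θ)⟩
    · simp only [hg, if_neg hs]
      exact TameFamily.of_continuous continuous_const ⟨1, fun _ => by simp⟩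
  have hprod : ∀ θ ω, ∏ s ∈ Finset.range (t + 1), g s θ (X (s + 1) ω)
      = ∏ s ∈ Finset.range (t + 1), lik s (X (s + 1) ω) (y s θ) := fun θ ω =>
    Finset.prod_congr rfl fun s hs => if_pos (Finset.mem_range.1 hs)
  -- The numerator runs ρ steps further than the denominator, because p is normalized by the norm of
  -- the filter before prediction.
  have hnum := hcons Θ g (fun _ => h) hgt (.of_continuous hh hb) (t + 1 + ρ)
  have hden := hcons Θ g (fun _ _ => 1) hgt (.of_continuous continuous_const ⟨1, fun _ => by simp⟩)
    (t + 1)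
  have hprod' : ∀ θ ω, ∏ s ∈ Finset.range (t + 1 + ρ), g s θ (X (s + 1) ω)
      = ∏ s ∈ Finset.range (t + 1), lik s (X (s + 1) ω) (y s θ) := fun θ ω => by
    rw [Finset.prod_range_add, hprod]
    refine (congrArg _ (Finset.prod_eq_one fun i _ => ?_)).trans (mul_one _)
    exact if_neg (by omega)
  have hlikpos : ∀ s x y, 0 < lik s x y := hobs.likelihood_pos
  have hgpos : ∀ s θ x, 0 < g s θ x := fun s θ x => by
    simp only [hg]; split_ifs <;> [exact hlikpos _ _ _; exact one_pos]
  choose c hc0 hc using fun s => exists_le_clamp_likelihood (obs := obs) hab hobs s R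
  choose Bg hBg using fun s => (hgt s).bounded
  obtain ⟨B, hB⟩ := hb
  have hpm : ∀ θ, Measurable fun ω => ∏ s ∈ Finset.range (t + 1), g s θ (X (s + 1) ω) := fun θ =>
    Finset.measurable_fun_prod _ fun s _ => ((hgt s).continuous θ).measurable.comp (hX (s + 1))
  have hple : ∀ θ ω, |∏ s ∈ Finset.range (t + 1), g s θ (X (s + 1) ω)|
      ≤ ∏ s ∈ Finset.range (t + 1), Bg s := fun θ ω => by
    rw [Finset.abs_prod]
    exact Finset.prod_le_prod (fun _ _ => abs_nonneg _) fun s _ => hBg s _ _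
  have hpi : ∀ θ, Integrable (fun ω => ∏ s ∈ Finset.range (t + 1), g s θ (X (s + 1) ω)) P :=
    fun θ => Integrable.of_bound (hpm θ).aestronglyMeasurable _ (ae_of_all _ (hple θ))
  simp only [hprod'] at hnum
  simp only [← hprod] at hnum ⊢
  simp only [one_mul] at hden
  have hdenlb : ∀ θ, ∏ s ∈ Finset.range (t + 1), c s
      ≤ ∫ ω, ∏ s ∈ Finset.range (t + 1), g s θ (X (s + 1) ω) ∂P := fun θ => by
    have h1 : ∫ _, ∏ s ∈ Finset.range (t + 1), c s ∂P
        ≤ ∫ ω, ∏ s ∈ Finset.range (t + 1), g s θ (X (s + 1) ω) ∂P := by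
      refine integral_mono (integrable_const _) (hpi θ) fun ω => ?_
      refine Finset.prod_le_prod (fun s _ => (hc0 s).le) fun s hs => ?_
      have hs' := Finset.mem_range.1 hs
      simp only [hg, if_pos hs']
      exact hc s _ _ (hy s (Nat.le_of_lt_succ hs') θ)
    simpa using h1
  have hnumle : ∀ θ, |∫ ω, h (X (t + 1 + ρ) ω) * ∏ s ∈ Finset.range (t + 1), g s θ (X (s + 1) ω) ∂P|
      ≤ |B| * ∏ s ∈ Finset.range (t + 1), Bg s := fun θ => by
    have := norm_integral_le_of_norm_le_const (μ := P)
      (f := fun ω => h (X (t + 1 + ρ) ω) * ∏ s ∈ Finset.range (t + 1), g s θ (X (s + 1) ω))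
      (C := |B| * ∏ s ∈ Finset.range (t + 1), Bg s) (ae_of_all _ fun ω => by
        rw [Real.norm_eq_abs, abs_mul]
        exact mul_le_mul ((hB _).trans (le_abs_self B)) (hple θ ω) (abs_nonneg _) (abs_nonneg _))
    simpa using this
  have key := hnum.div_of_bounded hden hnumle (Finset.prod_pos fun s _ => hc0 s) hdenlb
  rw [show t + ρ + 1 = t + 1 + ρ by omega]
  convert key using 1
  ext k θ
  set A := initialVector P a b (X 0) (k + 1) with hA
  have hA0 : ∀ l, 0 ≤ A l := fun l => measureReal_nonneg
  set G : ℕ → Grid M (k + 1) → ℝ := fun s l => g s θ (center a b (k + 1) l) with hG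
  have hE : unnormalizedFilter obs a b (k + 1) (Pm (k + 1)) A (fun s => y s θ) (t + 1)
      = weightedFilter (Pm (k + 1)) A G (t + 1) := by
    rw [unnormalizedFilter_eq_weightedFilter]
    refine weightedFilter_congr _ _ fun s hs => ?_
    ext l
    simp only [hG, hg, if_pos hs, hlik, obs.clamp_likelihood,
      clampBox_of_mem_box (center_mem_box hab (k + 1) l)]
  have hpow : (Pm (k + 1) ^ ρ).mulVec (weightedFilter (Pm (k + 1)) A G (t + 1))
      = weightedFilter (Pm (k + 1)) A G (t + 1 + ρ) := by
    rw [pow_mulVec_weightedFilter]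
    refine weightedFilter_congr _ _ fun s _ => ?_
    ext l
    by_cases hs : s < t + 1
    · simp only [hG, hg, if_pos hs]
    · simp only [hG, hg, if_neg hs]
  -- All entries are nonnegative, so the norm is the plain sum, which is the case F = 1 of
  -- consistency.
  have hl1 : l1 (weightedFilter (Pm (k + 1)) A G (t + 1))
      = ∑ l, weightedFilter (Pm (k + 1)) A G (t + 1) l :=
    Finset.sum_congr rfl fun l _ => abs_of_nonneg
      (weightedFilter_nonneg (hPm (k + 1)) hA0 (fun s l => (hgpos s θ _).le) _ _)
  simp only [predictive, hE, hpow, hl1, Pi.smul_apply, smul_eq_mul]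
  rw [div_eq_inv_mul, Finset.mul_sum]
  exact Finset.sum_congr rfl fun l _ => by ring

theorem gridCovariance_apply {k : ℕ} {ι : Type*} [Fintype ι] [DecidableEq ι]
    (Φ : Matrix (Fin k) ι ℝ) (p : ι → ℝ) (i j : Fin k) :
    gridCovariance Φ p i j
      = ∑ l, Φ i l * Φ j l * p l - (∑ l, Φ i l * p l) * ∑ l, Φ j l * p l := by
  unfold gridCovariance
  rw [Matrix.mul_sub, Matrix.sub_mul, Matrix.sub_apply, Matrix.mul_vecMulVec, Matrix.vecMulVec_mul,
    Matrix.vecMulVec_apply, Matrix.vecMul_transpose, Matrix.mul_apply]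
  congr 1
  refine Finset.sum_congr rfl fun l _ => ?_
  rw [Matrix.mul_diagonal, Matrix.transpose_apply]
  ring

/-- Tightness: the events that the observations up to T are bounded by n increase to the whole
space. -/
theorem exists_measurableSet_norm_le {E : Type*} [NormedAddCommGroup E] [MeasurableSpace E]
    [OpensMeasurableSpace E] {Y : ℕ → Ω → E} (hY : ∀ t, Measurable (Y t)) (T : ℕ) {η : ℝ}
    (hη : 0 < η) : ∃ (R : ℝ) (A : Set Ω), MeasurableSet A ∧ 1 - η ≤ P.real A ∧
      ∀ ω ∈ A, ∀ t ≤ T, ‖Y t ω‖ ≤ R := by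
  set A : ℕ → Set Ω := fun n => {ω | ∀ t ≤ T, ‖Y t ω‖ ≤ n} with hA
  have hmono : Monotone A := fun m n hmn ω hω t ht =>
    (hω t ht).trans (Nat.cast_le.2 hmn)
  have hunion : ⋃ n, A n = Set.univ := by
    refine Set.eq_univ_of_forall fun ω => Set.mem_iUnion.2 ?_
    obtain ⟨n, hn⟩ := exists_nat_ge (∑ t ∈ Finset.range (T + 1), ‖Y t ω‖)
    refine ⟨n, fun t ht => le_trans ?_ hn⟩
    exact Finset.single_le_sum (f := fun t => ‖Y t ω‖) (fun _ _ => norm_nonneg _)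
      (Finset.mem_range.2 (Nat.lt_succ_of_le ht))
  have hmeas : ∀ n, MeasurableSet (A n) := fun n => by
    have : A n = ⋂ t, ⋂ (_ : t ≤ T), {ω | ‖Y t ω‖ ≤ n} := by ext; simp [hA]
    rw [this]
    refine MeasurableSet.iInter fun t => MeasurableSet.iInter fun _ => ?_
    exact measurableSet_le (measurable_norm.comp (hY t)) measurable_const
  have hlim := tendsto_measure_iUnion_atTop (μ := P) hmono
  rw [hunion, measure_univ] at hlim
  have hlim' := (ENNReal.tendsto_toReal ENNReal.one_ne_top).comp hlim
  rw [ENNReal.toReal_one] at hlim'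
  obtain ⟨n, hn⟩ := (hlim'.eventually_const_lt (show 1 - η < 1 by linarith)).exists
  exact ⟨n, A n, hmeas n, le_of_lt hn, fun ω hω => hω⟩

-- If g is not integrable, the denominator is 0 by convention, and so is the ratio.
omit [IsProbabilityMeasure P] in
theorem abs_integral_mul_div_integral_le {h g : Ω → ℝ} (hg : ∀ ω, 0 ≤ g ω) {B : ℝ}
    (hB : ∀ ω, |h ω| ≤ B) : |(∫ ω, h ω * g ω ∂P) / ∫ ω, g ω ∂P| ≤ |B| := by
  by_cases hgi : Integrable g P
  · have hg' : 0 ≤ ∫ ω, g ω ∂P := integral_nonneg hg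
    rw [abs_div, abs_of_nonneg hg']
    refine div_le_of_le_mul₀ hg' (abs_nonneg _) ?_
    rw [← integral_const_mul]
    refine norm_integral_le_of_norm_le (f := fun ω => h ω * g ω) (hgi.const_mul |B|) (ae_of_all _ fun ω => ?_)
    rw [Real.norm_eq_abs, abs_mul, abs_of_nonneg (hg ω)]
    exact mul_le_mul_of_nonneg_right ((hB ω).trans (le_abs_self B)) (hg ω)
  · simp [integral_undef hgi]

/-- Each entry of either covariance combines the expectations of φ_i φ_j, φ_i and φ_j, so the
uniform convergence of normalized expectations is applied to these functions, with the sample points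
of A as parameters. -/
theorem exists_null_set_forall_entrywiseL1_le (hab : a < b) (hobs : obs.Regular (box M a b))
    (hX : ∀ n, Measurable (X n)) (hXbox : ∀ n, ∀ᵐ ω ∂P, X n ω ∈ box M a b)
    {u Y : ℕ → Ω → EuclideanSpace ℝ (Fin N)}
    (hu : ∀ t, Measurable (u t)) (huindep : iIndepFun u P)
    (hulaw : ∀ t, P.map (u t) = stdGaussian (EuclideanSpace ℝ (Fin N)))
    (hY : ∀ t, Measurable (Y t))
    (hobserve : ∀ t, ∀ᵐ ω ∂P, Y t ω = obs.observe t (X (t + 1) ω) (u t ω))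
    (hindep : IndepFun (fun ω n => X n ω) (fun ω t => u t ω) P)
    (hcons : FilterConsistent P a b X Pm)
    (hPm : ∀ (L : ℕ) [NeZero L] (i j : Grid M L), 0 ≤ Pm L i j)
    {T : ℕ} {R : ℝ} {A : Set Ω} (hA : ∀ ω ∈ A, ∀ t ≤ T, ‖Y t ω‖ ≤ R)
    {dim : ℕ → ℕ} {φ : ∀ t, (Fin M → ℝ) → Fin (dim t) → ℝ} (hφ : ∀ t, Continuous (φ t))
    (hφb : ∀ t, ∃ B : ℝ, ∀ x i, |φ t x i| ≤ B) (ρ : ℕ) :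
    ∃ N₀ : Set Ω, P N₀ = 0 ∧
      ∀ ε : ℝ, 0 < ε → ∃ L₀ : ℕ, ∀ (L : ℕ) [NeZero L], L₀ ≤ L →
        ∀ t ≤ T, ∀ ω ∈ A \ N₀,
          entrywiseL1
            (gridCovariance (functionalMatrix a b L (φ (t + ρ)))
                (predictive (Pm L) ρ
                  (unnormalizedFilter obs a b L (Pm L) (initialVector P a b (X 0) L)
                    (fun s => Y s ω) (t + 1)))
              - posteriorCovariance P (past Y t)
                  (fun ω' => φ (t + ρ) (X (t + ρ + 1) ω')) ω) ≤ ε := by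
  have hcl := hobs.isContinuous_clamp hab
  -- The states lie in the cube almost surely, so clamping does not change the observations.
  have hobserve' : ∀ t, ∀ᵐ ω ∂P, Y t ω = (obs.clamp a b).observe t (X (t + 1) ω) (u t ω) := by
    intro t
    filter_upwards [hobserve t, hXbox (t + 1)] with ω h1 h2
    rw [h1, obs.clamp_observe t h2]
  have hbdd : ∀ s (y : EuclideanSpace ℝ (Fin N)), ∃ B, ∀ x, (obs.clamp a b).likelihood s x y ≤ B := by
    intro s y
    obtain ⟨B, hB⟩ := (tameFamily_clamp_likelihood hab hcl s ‖y‖).bounded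
    exact ⟨B, fun x => (le_abs_self _).trans
      (hB ⟨y, mem_closedBall_zero_iff.2 le_rfl⟩ x)⟩
  set post : ((Fin M → ℝ) → ℝ) → ℕ → Ω → ℝ := fun h t ω =>
    (∫ ω', h (X (t + ρ + 1) ω') * ∏ s ∈ Finset.range (t + 1),
        (obs.clamp a b).likelihood s (X (s + 1) ω') (Y s ω) ∂P)
      / ∫ ω', ∏ s ∈ Finset.range (t + 1),
        (obs.clamp a b).likelihood s (X (s + 1) ω') (Y s ω) ∂P with hpost
  have hbayes : ∀ {h : (Fin M → ℝ) → ℝ}, Continuous h → ∀ {B}, (∀ x, |h x| ≤ B) → ∀ t,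
      P[fun ω => h (X (t + ρ + 1) ω) | past Y t] =ᵐ[P] post h t := fun hh _ hB t =>
    condExp_state_eq_ratio hcl hX hu huindep hulaw hY hobserve' hindep hbdd hh.measurable hB t
      (t + ρ + 1)
  choose B hB using hφb
  have hc1 : ∀ t (i : Fin (dim t)), Continuous fun x => φ t x i := fun t i =>
    (continuous_apply i).comp (hφ t)
  have hc2 : ∀ t (i j : Fin (dim t)), Continuous fun x => φ t x i * φ t x j := fun t i j =>
    (hc1 t i).mul (hc1 t j)
  have hb2 : ∀ t (i j : Fin (dim t)) x, |φ t x i * φ t x j| ≤ B t * B t := fun t i j x => by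
    rw [abs_mul]
    exact mul_le_mul (hB t x i) (hB t x j) (abs_nonneg _) ((abs_nonneg _).trans (hB t x i))
  have hae : ∀ᵐ ω ∂P, ∀ t, (∀ i, (P[fun ω' => φ (t + ρ) (X (t + ρ + 1) ω') i | past Y t]) ω
        = post (fun x => φ (t + ρ) x i) t ω) ∧
      ∀ i j, (P[fun ω' => φ (t + ρ) (X (t + ρ + 1) ω') i * φ (t + ρ) (X (t + ρ + 1) ω') j
        | past Y t]) ω = post (fun x => φ (t + ρ) x i * φ (t + ρ) x j) t ω := by
    rw [ae_all_iff]
    intro t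
    refine (ae_all_iff.2 fun i => ?_).and (ae_all_iff.2 fun i => ae_all_iff.2 fun j => ?_)
    · exact hbayes (hc1 (t + ρ) i) (fun x => hB _ x i) t
    · exact hbayes (hc2 (t + ρ) i j) (hb2 (t + ρ) i j) t
  -- The null set is where some conditional expectation differs from its Bayes ratio; it is fixed
  -- before ε, L and t. Its complement is a double negation, undone below by `not_not`.
  refine ⟨_, hae, fun ε hε => ?_⟩
  have hconv : ∀ t ≤ T, ∀ {h : (Fin M → ℝ) → ℝ}, Continuous h → (∃ B, ∀ x, |h x| ≤ B) →
      TendstoUniformly (fun (k : ℕ) (θ : A) => ∑ l, h (center a b (k + 1) l) *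
        predictive (Pm (k + 1)) ρ (unnormalizedFilter obs a b (k + 1) (Pm (k + 1))
          (initialVector P a b (X 0) (k + 1)) (fun s => Y s θ) (t + 1)) l)
        (fun θ => post h t θ) Filter.atTop := fun t ht h hh hb =>
    tendstoUniformly_predictive hab hcl hX hcons hPm (fun s (θ : A) => Y s θ) (R := R)
      (fun s hs θ => hA θ θ.2 s (hs.trans ht)) hh hb ρ
  -- Finitely many times and entries share one threshold. The tolerances add up to at most ε; the
  -- added 1 keeps the denominator positive when the dimension is 0.
  have hevent : ∀ᶠ k : ℕ in Filter.atTop, ∀ t ∈ Set.Iic T, ∀ i j : Fin (dim (t + ρ)), ∀ θ : A,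
      |gridCovariance (functionalMatrix a b (k + 1) (φ (t + ρ)))
        (predictive (Pm (k + 1)) ρ (unnormalizedFilter obs a b (k + 1) (Pm (k + 1))
          (initialVector P a b (X 0) (k + 1)) (fun s => Y s θ) (t + 1))) i j
        - (post (fun x => φ (t + ρ) x i * φ (t + ρ) x j) t θ
          - post (fun x => φ (t + ρ) x i) t θ * post (fun x => φ (t + ρ) x j) t θ)|
        ≤ ε / (dim (t + ρ) * dim (t + ρ) + 1) := by
    rw [Filter.eventually_all_finite (Set.finite_Iic T)]
    intro t ht
    rw [Filter.eventually_all]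
    intro i
    rw [Filter.eventually_all]
    intro j
    have hpb : ∀ i : Fin (dim (t + ρ)), ∃ D, ∀ θ : A, |post (fun x => φ (t + ρ) x i) t θ| ≤ D :=
      fun i => ⟨_, fun θ => abs_integral_mul_div_integral_le
        (fun ω => Finset.prod_nonneg fun s _ => (hcl.likelihood_pos s _ _).le)
        fun ω => hB _ (X (t + ρ + 1) ω) i⟩
    obtain ⟨Di, hDi⟩ := hpb i
    obtain ⟨Dj, hDj⟩ := hpb j
    have h1 := hconv t ht (hc2 (t + ρ) i j) ⟨_, hb2 (t + ρ) i j⟩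
    have h2 := (hconv t ht (hc1 (t + ρ) i) ⟨_, fun x => hB _ x i⟩).mul_of_bounded
      (hconv t ht (hc1 (t + ρ) j) ⟨_, fun x => hB _ x j⟩) hDi hDj
    obtain ⟨k₀, hk₀⟩ := tendstoUniformly_iff_abs_le.1 (h1.sub h2)
      (ε / (dim (t + ρ) * dim (t + ρ) + 1)) (by positivity)
    filter_upwards [Filter.eventually_ge_atTop k₀] with k hk θ
    have := hk₀ k hk θ
    rw [gridCovariance_apply]
    exact this
  obtain ⟨k₀, hk₀⟩ := Filter.eventually_atTop.1 hevent
  refine ⟨k₀ + 1, fun L hL hLk t ht ω hω => ?_⟩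
  obtain ⟨k, rfl⟩ : ∃ k, L = k + 1 := ⟨L - 1, by omega⟩
  have hω2 := not_not.1 hω.2 t
  have hle : ∀ i j, |(gridCovariance (functionalMatrix a b (k + 1) (φ (t + ρ)))
      (predictive (Pm (k + 1)) ρ (unnormalizedFilter obs a b (k + 1) (Pm (k + 1))
        (initialVector P a b (X 0) (k + 1)) (fun s => Y s ω) (t + 1)))
      - posteriorCovariance P (past Y t) (fun ω' => φ (t + ρ) (X (t + ρ + 1) ω')) ω) i j|
      ≤ ε / (dim (t + ρ) * dim (t + ρ) + 1) := by
    intro i j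
    have := hk₀ k (by omega) t ht i j ⟨ω, hω.1⟩
    rw [Matrix.sub_apply, posteriorCovariance, Matrix.of_apply, hω2.1 i, hω2.1 j, hω2.2 i j]
    exact this
  calc _ ≤ ∑ _i : Fin (dim (t + ρ)), ∑ _j : Fin (dim (t + ρ)),
        ε / (dim (t + ρ) * dim (t + ρ) + 1) :=
        Finset.sum_le_sum fun i _ => Finset.sum_le_sum fun j _ => hle i j
    _ = (dim (t + ρ) * dim (t + ρ)) * (ε / (dim (t + ρ) * dim (t + ρ) + 1)) := by
        simp [mul_assoc]
    _ ≤ (dim (t + ρ) * dim (t + ρ) + 1) * (ε / (dim (t + ρ) * dim (t + ρ) + 1)) := by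
        gcongr; linarith
    _ = ε := by field_simp

end Normalized

/-! ### The two settings combined -/

theorem theorem6 {Ω : Type*} [MeasurableSpace Ω] (P : Measure Ω) [IsProbabilityMeasure P]
    {M N : ℕ} (a b : ℝ) (hab : a < b)
    (obs : ObservationModel M N) (hobs : obs.Regular (box M a b))
    (X : ℕ → Ω → Fin M → ℝ) (hX : ∀ n, Measurable (X n))
    (hXbox : ∀ n, ∀ᵐ ω ∂P, X n ω ∈ box M a b)
    (u Y : ℕ → Ω → EuclideanSpace ℝ (Fin N))
    (hu : ∀ t, Measurable (u t)) (huindep : iIndepFun u P)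
    (hulaw : ∀ t, P.map (u t) = stdGaussian (EuclideanSpace ℝ (Fin N)))
    (hY : ∀ t, Measurable (Y t))
    (hobserve : ∀ t, ∀ᵐ ω ∂P, Y t ω = obs.observe t (X (t + 1) ω) (u t ω))
    (Pm : ∀ (L : ℕ) [NeZero L], Matrix (Grid M L) (Grid M L) ℝ)
    (hsetting :
      (∃ K : ProbabilityTheory.Kernel (Fin M → ℝ) (Fin M → ℝ),
        MarginalSetting P a b X u K ∧
        ∀ (L : ℕ) [NeZero L], Pm L = marginalTransition P a b X L) ∨
      (∃ (k : ℕ) (S : Set (Fin k → ℝ)) (f : (Fin M → ℝ) → (Fin k → ℝ) → Fin M → ℝ)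
        (W : ℕ → Ω → Fin k → ℝ),
        MarkovianSetting P a b X u S f W ∧
        ∀ (L : ℕ) [NeZero L], Pm L = markovianTransition (P.map (W 0)) a b f L))
    (T : ℕ) (C : ℝ) (hC : 1 ≤ C) :
    ∃ Ωhat : Set Ω, MeasurableSet Ωhat ∧
      1 - ((T : ℝ) + 1) ^ (1 - C * (N : ℝ)) * Real.exp (-(C * (N : ℝ))) ≤ P.real Ωhat ∧
      ∀ (dim : ℕ → ℕ) (φ : ∀ t, (Fin M → ℝ) → Fin (dim t) → ℝ),
        (∀ t, Continuous (φ t)) → (∀ t, ∃ B : ℝ, ∀ x i, |φ t x i| ≤ B) →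
        ∀ ρ : ℕ, ∃ N₀ : Set Ω, P N₀ = 0 ∧
          ∀ ε : ℝ, 0 < ε → ∃ L₀ : ℕ, ∀ (L : ℕ) [NeZero L], L₀ ≤ L →
            ∀ t ≤ T, ∀ ω ∈ Ωhat \ N₀,
              entrywiseL1
                (gridCovariance (functionalMatrix a b L (φ (t + ρ)))
                    (predictive (Pm L) ρ
                      (unnormalizedFilter obs a b L (Pm L) (initialVector P a b (X 0) L)
                        (fun s => Y s ω) (t + 1)))
                  - posteriorCovariance P (past Y t)
                      (fun ω' => φ (t + ρ) (X (t + ρ + 1) ω')) ω) ≤ ε := by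
  -- From here on the two settings are used only through these three properties.
  obtain ⟨hindep, hcons, hPm⟩ : IndepFun (fun ω n => X n ω) (fun ω t => u t ω) P ∧
      FilterConsistent P a b X Pm ∧ ∀ (L : ℕ) [NeZero L] (i j : Grid M L), 0 ≤ Pm L i j := by
    rcases hsetting with ⟨K, hs, hP⟩ | ⟨k, S, f, W, hs, hP⟩
    · obtain rfl : Pm = fun (L : ℕ) [NeZero L] => marginalTransition P a b X L := by
        funext L inst
        exact hP L
      exact ⟨hs.indep_noise, hs.filterConsistent hab hX hXbox, fun L _ => marginalTransition_nonneg L⟩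
    · obtain rfl : Pm = fun (L : ℕ) [NeZero L] => markovianTransition (P.map (W 0)) a b f L := by
        funext L inst
        exact hP L
      exact ⟨hs.indepFun_states, hs.filterConsistent hab hX hXbox,
        fun L _ i j => measureReal_nonneg⟩
  -- The stated bound on the exceptional probability enters only as a positive number η; R is chosen
  -- for it, before φ and ρ are given.
  obtain ⟨R, A, hA, hPA, hR⟩ := exists_measurableSet_norm_le (P := P) hY T
    (η := ((T : ℝ) + 1) ^ (1 - C * (N : ℝ)) * Real.exp (-(C * (N : ℝ)))) (by positivity)
  exact ⟨A, hA, hPA, fun dim φ hφ hφb ρ => exists_null_set_forall_entrywiseL1_le hab hobs hX hXbox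
    hu huindep hulaw hY hobserve hindep hcons hPm hR hφ hφb ρ⟩
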